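/- **Ergodicity of the $q$-thinning.** Let $\Gamma$ be an infinite group with a finite generating set $S$, and let $G=(V,E)$ be the associated Cayley graph: $V=\Gamma$, and distinct $u,v$ are adjacent iff $v=us$ or $u=vs$ for some $s\in S$. Let $\Omega=\{0,1\}^V$ carry its product (Borel) $\sigma$-algebra and the action $(\gamma\omega)(v)=\omega(\gamma^{-1}v)$ of $\Gamma$; let $\Gamma$ act diagonally on $\Omega^k$. For $X=\Omega$ or $X=\Omega^k$, a $\Gamma$-invariant Borel probability measure $\mu$ on $X$ is *ergodic* if $\mu(A)\in\{0,1\}$ for every measurable $A\subseteq X$ with $\gamma A=A$ for all $\gamma\in\Gamma$; write $E(\Gamma,X)$ for the set of all ergodic $\Gamma$-invariant Borel probability measures on $X$. The *clusters* of $\omega\in\Omega$ are the vertex sets of the connected components of the subgraph of $G$ induced by $\{v:\omega(v)=1\}$. A set $C\subseteq V$ has *frequency* $\alpha$ if for every $v\in V$ the simple random walk $(X_n)_{n\ge0}$ on $G$ started at $v$ satisfies $\lim_{N\to\infty}\frac1N\sum_{n=0}^{N-1}\mathbf 1_{\{X_n\in C\}}=\alpha$ almost surely. Let $\mathscr F\subseteq\Omega$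 be the event that some cluster of $\omega$ has a frequency $\alpha>0$. For $q\in[0,1]$ and a probability measure $\mu$ on $\Omega$, the *$q$-thinned measure* $\mu^q$ is the law of the configuration obtained by sampling $\omega$ with law $\mu$ and then, independently for each cluster of $\omega$, retaining the cluster with probability $q$ and deleting it with probability $1-q$. 1. If $\mu\in E(\Gamma,\Omega)$ and $\mu(\mathscr F)=0$, then $\mu^q\in E(\Gamma,\Omega)$ for every $q\in[0,1]$. 2. If $\nu_1,\dots,\nu_k\in E(\Gamma,\Omega)$ satisfy $\nu_i(\mathscr F)=0$ for every $1\le i\le k$ and $\nu_1\otimes\dots\otimes\nu_k\in E(\Gamma,\Omega^k)$, then $\nu_1^q\otimes\dots\otimes\nu_k^q\in E(\Gamma,\Omega^k)$ for every $q\in[0,1]$. -/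

import Mathlib

open MeasureTheory ProbabilityTheory Filter
open scoped unitInterval Topology

/-- Site configurations `{0,1}^V`, with the product (= Borel, for countable `V`) `σ`-algebra.
A vertex `v` is open in `ω` when `ω v = true`. -/
abbrev SiteConfig (V : Type*) : Type _ := V → Bool

/-- The action of `Γ` on `{0,1}^Γ` by left translation: `(γ • ω) v = ω (γ⁻¹ * v)`. -/
instance SiteConfig.instMulAction (Γ : Type*) [Group Γ] : MulAction Γ (SiteConfig Γ) where
  smul γ ω := fun v => ω (γ⁻¹ * v)
  one_smul ω := by
    funext v
    change ω (1⁻¹ * v) = ω v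
    simp
  mul_smul a b ω := by
    funext v
    change ω ((a * b)⁻¹ * v) = ω (b⁻¹ * (a⁻¹ * v))
    simp [mul_assoc]

/-- `μ` is an ergodic `Γ`-invariant probability measure on `X`.
(`ErgodicSMul` contains the invariance of `μ`.) -/
structure IsErgodicLaw (Γ : Type*) {X : Type*} [Group Γ] [MulAction Γ X] [MeasurableSpace X]
    (μ : Measure X) : Prop where
  isProbabilityMeasure : IsProbabilityMeasure μ
  ergodicSMul : ErgodicSMul Γ X μ

namespace SitePercolation

section Clusters

variable {V : Type*} (G : SimpleGraph V)

/-- The subgraph of `G` induced by the open vertices of `ω`. -/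
abbrev openGraph (ω : SiteConfig V) : SimpleGraph {v : V | ω v = true} :=
  G.induce {v : V | ω v = true}

/-- The clusters of `ω`: the vertex sets of the connected components of the open subgraph. -/
def clusters (ω : SiteConfig V) : Set (Set V) :=
  {C | ∃ c : (openGraph G ω).ConnectedComponent, C = Subtype.val '' c.supp}

open scoped Classical in
/-- The configuration obtained from `ω` by retaining the clusters labelled `true` by `ξ` and
deleting the others. -/
noncomputable def retain (ω : SiteConfig V) (ξ : (openGraph G ω).ConnectedComponent → Bool) :
    SiteConfig V :=
  fun v => if h : ω v = true then ξ ((openGraph G ω).connectedComponentMk ⟨v, h⟩) else false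

/-- The conditional law of the `q`-thinned configuration given `ω`: each cluster of `ω` is
retained with probability `q` and deleted otherwise, independently for distinct clusters. -/
noncomputable def thinLaw (q : I) (ω : SiteConfig V) : Measure (SiteConfig V) :=
  (Measure.infinitePi fun _ : (openGraph G ω).ConnectedComponent =>
    bernoulliMeasure true false q).map (retain G ω)

/-- The `q`-thinned measure `μ^q`: sample `ω` from `μ`, then thin its clusters. The integration
is legitimate because `ω ↦ thinLaw G q ω` is measurable, see `measurable_thinLaw`. -/
noncomputable def thinned (q : I) (μ : Measure (SiteConfig V)) : Measure (SiteConfig V) :=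
  μ.bind (thinLaw G q)

end Clusters

section Frequency

variable {Γ : Type*} [Group Γ]

/-- The walk `X₀ = v`, `Xₙ₊₁ = Xₙ zₙ` on `Γ`. -/
def walk (v : Γ) (z : ℕ → Γ) : ℕ → Γ
  | 0 => v
  | n + 1 => walk v z n * z n

/-- The law of the i.i.d. increments of simple random walk on the Cayley graph of `Γ` with
respect to `S`: each increment is uniform on the set of neighbours of the identity. As the
neighbours of `x` are the products of `x` with the neighbours of the identity, under this law
`walk v` is simple random walk on the graph started at `v`. -/
noncomputable def stepLaw [MeasurableSpace Γ] (S : Set Γ) : Measure (ℕ → Γ) :=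
  Measure.infinitePi fun _ : ℕ => uniformOn ((SimpleGraph.mulCayley S).neighborSet 1)

open scoped Pointwise in
/-- For a finite generating set of an infinite group, the increments form a genuine probability
space: the identity has finitely many neighbours, and at least one. -/
theorem isProbabilityMeasure_stepLaw [MeasurableSpace Γ] [DiscreteMeasurableSpace Γ] [Infinite Γ]
    {S : Set Γ} (hfin : S.Finite) (hgen : Subgroup.closure S = ⊤) :
    IsProbabilityMeasure (stepLaw S) := by
  have hsub : (SimpleGraph.mulCayley S).neighborSet 1 ⊆ S ∪ S⁻¹ := by
    intro u hu
    obtain ⟨_, g, hg, h | h⟩ := (SimpleGraph.mulCayley_adj' S 1 u).1 hu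
    · left; rwa [← h, one_mul]
    · right; rwa [Set.mem_inv, inv_eq_of_mul_eq_one_right h.symm]
  have hne : ((SimpleGraph.mulCayley S).neighborSet 1).Nonempty := by
    by_contra hempty
    have hS : S ⊆ {1} := by
      intro g hg
      by_contra hg1
      exact hempty ⟨g, (SimpleGraph.mulCayley_adj' S 1 g).2
        ⟨fun h => hg1 h.symm, g, hg, Or.inl (one_mul g)⟩⟩
    have hbot : Subgroup.closure S = ⊥ := Subgroup.closure_eq_bot_iff.2 hS
    have : (⊥ : Subgroup Γ) = ⊤ := hbot.symm.trans hgen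
    exact not_subsingleton Γ (Subgroup.subsingleton_iff.1 (subsingleton_of_bot_eq_top this))
  have := isProbabilityMeasure_uniformOn ((hfin.union hfin.inv).subset hsub) hne
  unfold stepLaw
  infer_instance

open scoped Classical in
/-- The proportion `N⁻¹ ∑_{n < N} 1{Xₙ ∈ C}` of the first `N` steps that `X` spends in `C`. -/
noncomputable def visitAverage (C : Set Γ) (X : ℕ → Γ) (N : ℕ) : ℝ :=
  (∑ n ∈ Finset.range N, if X n ∈ C then (1 : ℝ) else 0) / N

/-- `C` has frequency `α`: from every starting vertex, simple random walk almost surely spends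
an asymptotic proportion `α` of its time in `C`. -/
def HasFrequency [MeasurableSpace Γ] (S : Set Γ) (C : Set Γ) (α : ℝ) : Prop :=
  ∀ v : Γ, ∀ᵐ z ∂(stepLaw S), Tendsto (visitAverage C (walk v z)) atTop (𝓝 α)

/-- The event `𝓕` that some cluster has positive frequency. -/
def positiveFrequencyEvent [MeasurableSpace Γ] (S : Set Γ) : Set (SiteConfig Γ) :=
  {ω | ∃ C ∈ clusters (SimpleGraph.mulCayley S) ω, ∃ α : ℝ, 0 < α ∧ HasFrequency S C α}

end Frequency

section Measurability

variable {V : Type*} (G : SimpleGraph V)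

/-- `v` and `u` lie in the same cluster of `ω`. -/
def SameCluster (ω : SiteConfig V) (v u : V) : Prop :=
  ∃ (hv : ω v = true) (hu : ω u = true), (openGraph G ω).Reachable ⟨v, hv⟩ ⟨u, hu⟩

theorem measurableSet_sameCluster [Countable V] (v u : V) :
    MeasurableSet {ω : SiteConfig V | SameCluster G ω v u} := by
  let R : ℕ → V → SiteConfig V → Prop := fun n => Nat.rec (fun u ω => ω v = true ∧ u = v)
    (fun _ P u ω => ∃ w, P w ω ∧ G.Adj w u ∧ ω u = true) n
  have hopen : ∀ u : V, MeasurableSet {ω : SiteConfig V | ω u = true} := fun u =>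
    (measurable_pi_apply (X := fun _ : V => Bool) u) (measurableSet_singleton true)
  have hR : ∀ n u, MeasurableSet {ω | R n u ω} := by
    intro n
    induction n with
    | zero => exact fun u => (hopen v).inter (MeasurableSet.const _)
    | succ n ih =>
      intro u
      have : {ω | R (n + 1) u ω} =
          ⋃ w, {ω | R n w ω} ∩ ({_ω | G.Adj w u} ∩ {ω | ω u = true}) := by
        ext ω; simp [R]
      rw [this]
      exact MeasurableSet.iUnion fun w => (ih w).inter ((MeasurableSet.const _).inter (hopen u))
  have key : {ω : SiteConfig V | SameCluster G ω v u} = ⋃ n, {ω | R n u ω} := by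
    ext ω
    simp only [Set.mem_ofPred_eq, Set.mem_iUnion]
    constructor
    · rintro ⟨hv, hu, h⟩
      rw [SimpleGraph.reachable_iff_reflTransGen] at h
      have : ∀ y : {v : V | ω v = true},
          Relation.ReflTransGen (openGraph G ω).Adj ⟨v, hv⟩ y → ∃ n, R n y.1 ω := by
        intro y hy
        induction hy with
        | refl => exact ⟨0, hv, rfl⟩
        | @tail b c _ hbc ih =>
          obtain ⟨n, hn⟩ := ih
          exact ⟨n + 1, b.1, hn, hbc, c.2⟩
      exact this _ h
    · rintro ⟨n, hn⟩
      induction n generalizing u with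
      | zero =>
        obtain ⟨hv, rfl⟩ := hn
        exact ⟨hv, hv, SimpleGraph.Reachable.refl _⟩
      | succ n ih =>
        obtain ⟨w, hw, hadj, hu⟩ := hn
        obtain ⟨hv, hw', hr⟩ := ih w hw
        refine ⟨hv, hu, hr.trans (SimpleGraph.Adj.reachable ?_)⟩
        exact hadj
  rw [key]
  exact MeasurableSet.iUnion fun n => hR n u

/-- The conditional law of the thinned configuration depends measurably on the configuration. -/
theorem measurable_thinLaw [Countable V] (q : I) : Measurable (thinLaw G q) := by
  classical
  let _ : Encodable V := Encodable.ofCountable V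
  let _ : MeasurableSpace V := ⊤
  -- `rep ω v` is the vertex of least index in the cluster of `v`.
  let P : SiteConfig V → V → V → Prop := fun ω v u =>
    SameCluster G ω v u ∧ ∀ w, SameCluster G ω v w → Encodable.encode u ≤ Encodable.encode w
  have hPmeas : ∀ v u, MeasurableSet {ω | P ω v u} := by
    intro v u
    have : {ω | P ω v u} = {ω | SameCluster G ω v u} ∩
        ⋂ w, ({ω | SameCluster G ω v w}ᶜ ∪ {_ω | Encodable.encode u ≤ Encodable.encode w}) := by
      ext ω; simp [P, imp_iff_not_or]
    rw [this]
    exact (measurableSet_sameCluster G v u).inter (MeasurableSet.iInter fun w =>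
      (measurableSet_sameCluster G v w).compl.union (MeasurableSet.const _))
  have hPuniq : ∀ ω v u u', P ω v u → P ω v u' → u = u' := fun ω v u u' h h' =>
    Encodable.encode_injective (le_antisymm (h.2 _ h'.1) (h'.2 _ h.1))
  have hPex : ∀ ω v, ω v = true → ∃ u, P ω v u := by
    intro ω v hv
    have hne : ({u | SameCluster G ω v u} : Set V).Nonempty :=
      ⟨v, hv, hv, SimpleGraph.Reachable.refl _⟩
    obtain ⟨u, hu, hmin⟩ := WellFounded.has_min (measure (Encodable.encode (α := V))).wf _ hne
    exact ⟨u, hu, fun w hw => not_lt.mp (hmin w hw)⟩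
  let F : SiteConfig V × (V → Bool) → SiteConfig V := fun p v =>
    decide (∃ u, P p.1 v u ∧ p.2 u = true)
  have hF : Measurable F := by
    refine measurable_pi_lambda _ fun v => ?_
    refine measurable_to_bool ?_
    have : (fun p => F p v) ⁻¹' {true} =
        ⋃ u, (Prod.fst ⁻¹' {ω | P ω v u}) ∩ (Prod.snd ⁻¹' {ξ | ξ u = true}) := by
      ext p; simp [F]
    rw [this]
    exact MeasurableSet.iUnion fun u => (measurable_fst (hPmeas v u)).inter
      (measurable_snd ((measurable_pi_apply (X := fun _ : V => Bool) u)
        (measurableSet_singleton true)))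
  let ν : Measure (V → Bool) := Measure.infinitePi fun _ : V => bernoulliMeasure true false q
  have key : ∀ ω, thinLaw G q ω = ν.map (fun ξ => F (ω, ξ)) := by
    intro ω
    have hrep : ∀ c : (openGraph G ω).ConnectedComponent, ∃ u : V, ∃ hu : ω u = true,
        (openGraph G ω).connectedComponentMk ⟨u, hu⟩ = c ∧
          ∀ v (hv : ω v = true), (openGraph G ω).connectedComponentMk ⟨v, hv⟩ = c → P ω v u := by
      intro c
      induction c using SimpleGraph.ConnectedComponent.ind with
      | h x =>
        obtain ⟨u, hu⟩ := hPex ω x.1 x.2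
        obtain ⟨hx, hu', hr⟩ := hu.1
        refine ⟨u, hu', SimpleGraph.ConnectedComponent.sound hr.symm, fun v hv hvc => ?_⟩
        have hvx : (openGraph G ω).Reachable ⟨v, hv⟩ x := SimpleGraph.ConnectedComponent.exact hvc
        refine ⟨⟨hv, hu', hvx.trans hr⟩, fun w hw => hu.2 w ?_⟩
        obtain ⟨_, hw', hvw⟩ := hw
        exact ⟨hx, hw', hvx.symm.trans hvw⟩
    choose f hf hfc hfP using hrep
    have hfinj : Function.Injective f := by
      intro c c' h
      rw [← hfc c, ← hfc c']
      congr 1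
      exact Subtype.ext h
    have hmap : (Measure.infinitePi fun _ : (openGraph G ω).ConnectedComponent =>
        bernoulliMeasure true false q) = ν.map (fun ξ c => ξ (f c)) := by
      symm
      refine Measure.eq_infinitePi _ fun s t ht => ?_
      have hm : Measurable (fun (ξ : V → Bool) c => ξ (f c)) :=
        measurable_pi_lambda _ fun c => measurable_pi_apply _
      rw [Measure.map_apply hm (MeasurableSet.pi s.countable_toSet fun c _ => ht c)]
      have : (fun (ξ : V → Bool) c => ξ (f c)) ⁻¹' (Set.pi s t) =
          Set.pi (s.image f : Finset V) (fun u => {b | ∀ c, f c = u → b ∈ t c}) := by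
        ext ξ
        simp only [Set.mem_preimage, Set.mem_pi, Finset.mem_coe, Finset.mem_image,
          Set.mem_ofPred_eq, forall_exists_index, and_imp]
        constructor
        · rintro h u c hc rfl c' hc'
          rw [← hc', hfinj hc']
          exact h c hc
        · exact fun h c hc => h _ c hc rfl c rfl
      rw [this, Measure.infinitePi_pi _ (fun _ _ => MeasurableSet.of_discrete),
        Finset.prod_image (fun _ _ _ _ h => hfinj h)]
      refine Finset.prod_congr rfl fun c _ => ?_
      congr 1
      ext b
      simp only [Set.mem_ofPred_eq]
      exact ⟨fun h => h c rfl, fun h c' hc' => hfinj hc' ▸ h⟩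
    have hret : Measurable (retain G ω) := by
      refine measurable_pi_lambda _ fun v => ?_
      by_cases h : ω v = true
      · simpa [retain, h] using measurable_pi_apply _
      · simp [retain, h]
    rw [thinLaw, hmap, Measure.map_map hret
      (measurable_pi_lambda _ fun c => measurable_pi_apply _)]
    congr 1
    funext ξ v
    by_cases h : ω v = true
    · have hP := hfP _ v h rfl
      simp only [Function.comp_apply, retain, h, dif_pos, F]
      rw [Bool.eq_iff_iff, decide_eq_true_iff]
      constructor
      · exact fun hξ => ⟨_, hP, hξ⟩
      · rintro ⟨u, hu, hξ⟩
        rwa [hPuniq _ _ _ _ hP hu]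
    · have : ¬ ∃ u, P ω v u ∧ ξ u = true := by
        rintro ⟨u, hu, _⟩
        exact h hu.1.1
      simp [retain, h, F, this]
  refine Measure.measurable_of_measurable_coe _ fun s hs => ?_
  have : (fun ω => thinLaw G q ω s) = fun ω => ν (Prod.mk ω ⁻¹' (F ⁻¹' s)) := by
    funext ω
    rw [key]
    exact Measure.map_apply (hF.comp measurable_prodMk_left) hs
  rw [this]
  exact measurable_measure_prodMk_left (hF hs)

end Measurability

end SitePercolation

/-! The thinned measure is a mixture over `ω` of the laws `thinLaw G q ω`, which are equivariant. If
`s` is an invariant event, its conditional probability given `ω` is an invariant function of `ω`,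
hence almost surely a constant `c` by ergodicity of the base measure. Approximate `s` by an event
`B` that depends on a finite set `K` of vertices. If no cluster of `ω` meets both `K` and `gK`, then
`B` and its translate read disjoint sets of coins and are conditionally independent. As both
approximate `s`, this gives `c ≈ c²`, so `c` is 0 or 1 (`IsErgodicLaw.bind`,
`indepFun_restrict_thinLaw`). The same argument serves product measures, with all coordinates
thinned independently.

It remains to find `g` such that `K` and `gK` are unlikely to be connected
(`exists_translate_connection_le`). Take `g` to be the position `Xₙ` of an independent random walk:
if the cluster of `x` has frequency zero, the probability that `x` is connected to `Xₙ` has Cesàro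
means tending to 0, and the same follows for `Xₙy`.

The hypothesis only excludes positive frequencies, so one must also show that every cluster has a
frequency (`ae_forall_cluster_hasFrequency`). Birkhoff's theorem for the environment seen from the
walk, with an `L²` argument showing that the limit does not depend on the walk, gives a frequency to
the open set of any stationary configuration (`ae_exists_tendsto_walk_average`). Applied to the
thinning with fair coins, before and after flipping the coin of one cluster, it gives two open sets
that differ exactly by that cluster. -/

/-! ### Birkhoff's pointwise ergodic theorem -/

/-- `hopfMax T f n x` is the maximum of the Birkhoff sums of `f` at `x` of length at most `n`. -/
noncomputable def hopfMax {X : Type*} (T : X → X) (f : X → ℝ) : ℕ → X → ℝ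
  | 0 => fun _ => 0
  | n + 1 => fun x => max 0 (f x + hopfMax T f n (T x))

section Birkhoff

variable {X : Type*} {T : X → X} {f : X → ℝ}

theorem hopfMax_nonneg (n : ℕ) (x : X) : 0 ≤ hopfMax T f n x := by
  cases n with
  | zero => exact le_rfl
  | succ n => exact le_max_left _ _

theorem hopfMax_le_succ (n : ℕ) (x : X) : hopfMax T f n x ≤ hopfMax T f (n + 1) x := by
  induction n generalizing x with
  | zero => exact le_max_left _ _
  | succ n ih => exact max_le_max le_rfl (add_le_add le_rfl (ih (T x)))

theorem birkhoffSum_le_hopfMax (n : ℕ) (x : X) : birkhoffSum T f n x ≤ hopfMax T f n x := by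
  induction n generalizing x with
  | zero => simp [hopfMax]
  | succ n ih =>
    rw [birkhoffSum_succ']
    exact (add_le_add le_rfl (ih (T x))).trans (le_max_right _ _)

theorem Filter.Frequently.lt_of_tendsto_sub {u v : ℕ → ℝ} {b c : ℝ} (hbc : b < c)
    (h : ∃ᶠ n in atTop, c < u n) (huv : Tendsto (fun n => u n - v n) atTop (𝓝 0)) :
    ∃ᶠ n in atTop, b < v n := by
  have := huv.eventually (gt_mem_nhds (sub_pos.2 hbc))
  refine (h.and_eventually this).mono fun n hn => ?_
  linarith [hn.1, hn.2]

/-- The set of points at which the limit superior of the Birkhoff averages of `f` exceeds `b`. -/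
def birkhoffUpper (T : X → X) (f : X → ℝ) (b : ℝ) : Set X :=
  {x | ∃ c : ℚ, b < c ∧ ∃ᶠ n in atTop, (c : ℝ) < birkhoffAverage ℝ T f n x}

/-- The averages at `x` and at `T x` differ by a quantity tending to 0, and the strict rational
margin in `birkhoffUpper` absorbs this error. -/
theorem preimage_birkhoffUpper {C : ℝ} (hC : ∀ x, |f x| ≤ C) (b : ℝ) :
    T ⁻¹' birkhoffUpper T f b = birkhoffUpper T f b := by
  have hlim : ∀ x, Tendsto (fun n => birkhoffAverage ℝ T f n (T x) - birkhoffAverage ℝ T f n x)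
      atTop (𝓝 0) := by
    intro x
    refine tendsto_birkhoffAverage_apply_sub_birkhoffAverage ℝ ?_
    refine isBounded_iff_forall_norm_le.2 ⟨C, ?_⟩
    rintro _ ⟨n, rfl⟩
    exact hC _
  ext x
  constructor
  · rintro ⟨c, hc, h⟩
    obtain ⟨c', h1, h2⟩ := exists_rat_btwn hc
    exact ⟨c', h1, h.lt_of_tendsto_sub h2 (hlim x)⟩
  · rintro ⟨c, hc, h⟩
    obtain ⟨c', h1, h2⟩ := exists_rat_btwn hc
    refine ⟨c', h1, h.lt_of_tendsto_sub h2 ?_⟩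
    simpa using (hlim x).neg

theorem abs_birkhoffAverage_le {C : ℝ} (hC : ∀ x, |f x| ≤ C) (n : ℕ) (x : X) :
    |birkhoffAverage ℝ T f n x| ≤ C := by
  have hC0 : 0 ≤ C := (abs_nonneg _).trans (hC x)
  rw [birkhoffAverage, smul_eq_mul, abs_mul, abs_inv, Nat.abs_cast]
  have : |birkhoffSum T f n x| ≤ n * C := by
    refine (Finset.abs_sum_le_sum_abs _ _).trans ?_
    refine (Finset.sum_le_sum fun k _ => hC _).trans ?_
    simp
  rcases Nat.eq_zero_or_pos n with rfl | hn
  · simpa using hC0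
  · rw [inv_mul_le_iff₀ (Nat.cast_pos.2 hn)]
    exact this

variable [MeasurableSpace X] {μ : Measure X}

theorem measurable_hopfMax (hT : Measurable T) (hf : Measurable f) (n : ℕ) :
    Measurable (hopfMax T f n) := by
  induction n with
  | zero => exact measurable_const
  | succ n ih => exact measurable_const.max (hf.add (ih.comp hT))

theorem integrable_hopfMax (hT : MeasurePreserving T μ μ) (hf : Integrable f μ) (n : ℕ) :
    Integrable (hopfMax T f n) μ := by
  induction n with
  | zero => exact integrable_zero _ _ _
  | succ n ih => exact (integrable_zero _ _ _).sup (hf.add (hT.integrable_comp_of_integrable ih))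

/-- The maximal ergodic theorem, in the case where almost every point has a positive Birkhoff
sum. -/
theorem integral_nonneg_of_ae_exists_birkhoffSum_pos (hT : MeasurePreserving T μ μ)
    (hfm : Measurable f) (hf : Integrable f μ) (h : ∀ᵐ x ∂μ, ∃ n, 0 < birkhoffSum T f n x) :
    0 ≤ ∫ x, f x ∂μ := by
  let A : ℕ → Set X := fun n => {x | 0 < hopfMax T f (n + 1) x}
  have hA : ∀ n, MeasurableSet (A n) := fun n =>
    measurableSet_lt measurable_const (measurable_hopfMax hT.measurable hfm _)
  have hmono : Monotone A := monotone_nat_of_le_succ fun n x hx =>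
    lt_of_lt_of_le hx (hopfMax_le_succ _ _)
  have hint : ∀ n, 0 ≤ ∫ x in A n, f x ∂μ := by
    intro n
    have hi := integrable_hopfMax hT hf
    have hiT : Integrable (fun x => hopfMax T f n (T x)) μ :=
      hT.integrable_comp_of_integrable (hi n)
    -- Write `Mₙ` for `hopfMax T f n`. On `A n` the recursion gives `f = Mₙ₊₁ - Mₙ ∘ T`. Integrating
    -- `Mₙ₊₁` over `A n` loses nothing, since it vanishes elsewhere, while `∫ Mₙ ∘ T = ∫ Mₙ ≤ ∫
    -- Mₙ₊₁`.
    have h1 : ∫ x in A n, f x ∂μ =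
        ∫ x in A n, (hopfMax T f (n + 1) x - hopfMax T f n (T x)) ∂μ := by
      refine setIntegral_congr_fun (hA n) fun x hx => ?_
      have hx' : 0 < max 0 (f x + hopfMax T f n (T x)) := hx
      have : hopfMax T f (n + 1) x = f x + hopfMax T f n (T x) := by
        change max 0 _ = _
        rcases lt_max_iff.1 hx' with h0 | h0
        · exact absurd h0 (lt_irrefl _)
        · exact max_eq_right h0.le
      simp [this]
    rw [h1, integral_sub (hi (n + 1)).integrableOn hiT.integrableOn]
    have h2 : ∫ x in A n, hopfMax T f (n + 1) x ∂μ = ∫ x, hopfMax T f (n + 1) x ∂μ := by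
      refine setIntegral_eq_integral_of_forall_compl_eq_zero fun x hx => ?_
      exact le_antisymm (not_lt.1 hx) (hopfMax_nonneg _ _)
    have h3 : ∫ x in A n, hopfMax T f n (T x) ∂μ ≤ ∫ x, hopfMax T f n (T x) ∂μ :=
      setIntegral_le_integral hiT (Eventually.of_forall fun x => hopfMax_nonneg _ _)
    have h4 : ∫ x, hopfMax T f n (T x) ∂μ = ∫ x, hopfMax T f n x ∂μ := by
      conv_rhs => rw [← hT.map_eq]
      rw [integral_map hT.measurable.aemeasurable]
      exact (measurable_hopfMax hT.measurable hfm n).aestronglyMeasurable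
    have h5 : ∫ x, hopfMax T f n x ∂μ ≤ ∫ x, hopfMax T f (n + 1) x ∂μ :=
      integral_mono (hi n) (hi (n + 1)) fun x => hopfMax_le_succ n x
    linarith
  have hlim := tendsto_setIntegral_of_monotone hA hmono hf.integrableOn
  have hU : (⋃ n, A n) =ᵐ[μ] (Set.univ : Set X) := by
    rw [eventuallyEq_univ]
    filter_upwards [h] with x ⟨n, hn⟩
    exact Set.mem_iUnion.2
      ⟨n, lt_of_lt_of_le hn ((birkhoffSum_le_hopfMax n x).trans (hopfMax_le_succ n x))⟩
  rw [setIntegral_congr_set hU, setIntegral_univ] at hlim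
  exact ge_of_tendsto' hlim hint

theorem measurable_birkhoffAverage (hT : Measurable T) (hf : Measurable f) (n : ℕ) :
    Measurable (birkhoffAverage ℝ T f n) := by
  have : Measurable fun x => (n : ℝ)⁻¹ * ∑ k ∈ Finset.range n, f (T^[k] x) :=
    (Finset.measurable_fun_sum _ fun k _ => hf.comp (hT.iterate k)).const_mul _
  exact this

theorem measurableSet_birkhoffUpper (hT : Measurable T) (hf : Measurable f) (b : ℝ) :
    MeasurableSet (birkhoffUpper T f b) := by
  have : birkhoffUpper T f b = ⋃ c : ℚ, ⋃ (_ : b < c), ⋂ N : ℕ, ⋃ n : ℕ, ⋃ (_ : N ≤ n),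
      {x | (c : ℝ) < birkhoffAverage ℝ T f n x} := by
    ext x
    simp [birkhoffUpper, frequently_atTop]
  rw [this]
  refine .iUnion fun c => .iUnion fun _ => .iInter fun N => .iUnion fun n => .iUnion fun _ => ?_
  exact measurableSet_lt measurable_const (measurable_birkhoffAverage hT hf n)

/-- The maximal ergodic theorem applies to `f - b`, since an average of `f` above `b` is a positive
Birkhoff sum of `f - b`. -/
theorem mul_measureReal_le_integral_of_subset_birkhoffUpper [IsFiniteMeasure μ]
    (hT : MeasurePreserving T μ μ) (hfm : Measurable f) (hf : Integrable f μ) {b : ℝ}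
    (h : ∀ᵐ x ∂μ, x ∈ birkhoffUpper T f b) : b * μ.real Set.univ ≤ ∫ x, f x ∂μ := by
  have key : 0 ≤ ∫ x, (f x - b) ∂μ := by
    refine integral_nonneg_of_ae_exists_birkhoffSum_pos hT (hfm.sub_const b)
      (hf.sub (integrable_const b)) ?_
    filter_upwards [h] with x ⟨c, hc, hx⟩
    -- The empty average is 0 by convention and says nothing about a sum, so `n = 0` is excluded.
    obtain ⟨n, hn, hn0⟩ := (hx.and_eventually (eventually_gt_atTop 0)).exists
    refine ⟨n, ?_⟩
    have hn0' : (0 : ℝ) < n := Nat.cast_pos.2 hn0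
    have h1 : (b : ℝ) * n < birkhoffSum T f n x := by
      rw [birkhoffAverage, smul_eq_mul, inv_mul_eq_div, lt_div_iff₀ hn0'] at hn
      nlinarith
    have h2 : birkhoffSum T (fun x => f x - b) n x = birkhoffSum T f n x - n * b := by
      simp [birkhoffSum, Finset.sum_sub_distrib]
    rw [h2]
    linarith
  rw [integral_sub hf (integrable_const b), integral_const, smul_eq_mul] at key
  linarith

/-- Birkhoff's pointwise ergodic theorem for bounded functions: the Birkhoff averages converge
almost everywhere. -/
theorem ae_exists_tendsto_birkhoffAverage [IsFiniteMeasure μ] (hT : MeasurePreserving T μ μ)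
    (hf : Measurable f) {C : ℝ} (hC : ∀ x, |f x| ≤ C) :
    ∀ᵐ x ∂μ, ∃ l, Tendsto (fun n => birkhoffAverage ℝ T f n x) atTop (𝓝 l) := by
  have hneg : ∀ n x, birkhoffAverage ℝ T (fun x => -f x) n x = -birkhoffAverage ℝ T f n x := by
    intro n x
    simp [birkhoffAverage, birkhoffSum]
  have hnull : ∀ a b : ℚ, a < b → ∀ᵐ x ∂μ,
      ¬ (x ∈ birkhoffUpper T (fun x => -f x) (-a) ∧ x ∈ birkhoffUpper T f b) := by
    intro a b hab
    -- On this invariant set the averages oscillate across `[a, b]`. The one-sided bounds for `f`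
    -- and `-f` on the restricted measure give `b μ(E) ≤ ∫ f ≤ a μ(E)` over `E`, so `E` is null.
    let E : Set X := birkhoffUpper T (fun x => -f x) (-a) ∩ birkhoffUpper T f b
    have hE : MeasurableSet E := (measurableSet_birkhoffUpper hT.measurable hf.neg _).inter
      (measurableSet_birkhoffUpper hT.measurable hf _)
    have hTE : T ⁻¹' E = E := by
      rw [Set.preimage_inter, preimage_birkhoffUpper (C := C) (by simpa using hC),
        preimage_birkhoffUpper hC]
    have hTr : MeasurePreserving T (μ.restrict E) (μ.restrict E) := by
      have := hT.restrict_preimage hE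
      rwa [hTE] at this
    have hfi : Integrable f (μ.restrict E) :=
      Integrable.of_bound hf.aestronglyMeasurable C (Eventually.of_forall hC)
    have h1 := mul_measureReal_le_integral_of_subset_birkhoffUpper hTr hf hfi (b := b)
      (by filter_upwards [ae_restrict_mem hE] with x hx using hx.2)
    have h2 := mul_measureReal_le_integral_of_subset_birkhoffUpper hTr hf.neg hfi.neg (b := -a)
      (by filter_upwards [ae_restrict_mem hE] with x hx using hx.1)
    simp only [Pi.neg_apply, integral_neg] at h2
    have h3 : (μ.restrict E).real Set.univ = 0 := by
      have hab' : (a : ℝ) < b := by exact_mod_cast hab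
      have := measureReal_nonneg (μ := μ.restrict E) (s := Set.univ)
      nlinarith
    rw [measureReal_restrict_apply_univ, measureReal_eq_zero_iff] at h3
    exact measure_eq_zero_iff_ae_notMem.1 h3
  have hall : ∀ᵐ x ∂μ, ∀ a b : ℚ, a < b →
      ¬ (x ∈ birkhoffUpper T (fun x => -f x) (-a) ∧ x ∈ birkhoffUpper T f b) := by
    rw [ae_all_iff]; intro a; rw [ae_all_iff]; intro b
    by_cases hab : a < b
    · filter_upwards [hnull a b hab] with x hx _ using hx
    · exact Eventually.of_forall fun x h => absurd h hab
  filter_upwards [hall] with x hx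
  refine tendsto_of_no_upcrossings (s := Set.univ) dense_univ ?_ ?_ ?_
  · rintro a - b - hab ⟨ha, hb⟩
    -- The real levels `a < b` are replaced by rational levels `c < d` strictly between them; `c'`
    -- and `b'` provide the margins that `birkhoffUpper` requires.
    obtain ⟨c, hac, hcb⟩ := exists_rat_btwn hab
    obtain ⟨d, hcd, hdb⟩ := exists_rat_btwn hcb
    obtain ⟨b', hb1, hb2⟩ := exists_rat_btwn hdb
    obtain ⟨c', hc1, hc2⟩ := exists_rat_btwn hac
    refine hx c d (by exact_mod_cast hcd) ⟨⟨-c', by push_cast; linarith, ?_⟩, ⟨b', hb1, ?_⟩⟩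
    · refine ha.mono fun n hn => ?_
      rw [hneg]; push_cast; linarith
    · exact hb.mono fun n hn => hb2.trans hn
  · exact isBoundedUnder_of ⟨C, fun n => (abs_le.1 (abs_birkhoffAverage_le hC n x)).2⟩
  · exact isBoundedUnder_of ⟨-C, fun n => (abs_le.1 (abs_birkhoffAverage_le hC n x)).1⟩

end Birkhoff

/-! ### Splitting off the first term of an i.i.d. sequence -/

section HeadTail

variable {A : Type*} [MeasurableSpace A] (ρ : Measure A) [IsProbabilityMeasure ρ]

theorem infinitePi_map_cons :
    (ρ.prod (Measure.infinitePi fun _ : ℕ => ρ)).map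
      (fun p n => Nat.casesOn n p.1 p.2 : A × (ℕ → A) → ℕ → A) =
    Measure.infinitePi fun _ : ℕ => ρ := by
  classical
  have hm : Measurable (fun p n => Nat.casesOn n p.1 p.2 : A × (ℕ → A) → ℕ → A) := by
    refine measurable_pi_lambda _ fun n => ?_
    cases n with
    | zero => exact measurable_fst
    | succ n => exact (measurable_pi_apply n).comp measurable_snd
  refine Measure.eq_infinitePi _ fun s t ht => ?_
  obtain ⟨N, hN⟩ := s.exists_nat_subset_range
  -- Padding with full factors turns the cylinder into one over an initial segment that contains 0,
  -- from which coordinate 0 splits off.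
  let t' : ℕ → Set A := fun i => if i ∈ s then t i else Set.univ
  have ht' : ∀ i, MeasurableSet (t' i) := by
    intro i
    by_cases h : i ∈ s
    · simpa [t', h] using ht i
    · simp [t', h]
  have hpi : Set.pi (s : Set ℕ) t = Set.pi (Finset.range (N + 1) : Set ℕ) t' := by
    ext x
    simp only [Set.mem_pi, Finset.mem_coe, t']
    constructor
    · intro h i _
      by_cases hi : i ∈ s
      · simpa [hi] using h i hi
      · simp [hi]
    · intro h i hi
      have := h i (Finset.range_mono (Nat.le_succ N) (hN hi))
      simpa [hi] using this
  have hprod : ∏ i ∈ s, ρ (t i) = ∏ i ∈ Finset.range (N + 1), ρ (t' i) := by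
    rw [← Finset.prod_subset (hN.trans (Finset.range_mono (Nat.le_succ N)))]
    · exact Finset.prod_congr rfl fun i hi => by simp [t', hi]
    · intro i _ hi
      simp [t', hi]
  have hpre : (fun p n => Nat.casesOn n p.1 p.2 : A × (ℕ → A) → ℕ → A) ⁻¹'
      Set.pi (Finset.range (N + 1) : Set ℕ) t' =
      t' 0 ×ˢ Set.pi (Finset.range N : Set ℕ) (fun n => t' (n + 1)) := by
    ext p
    simp only [Set.mem_preimage, Set.mem_pi, Finset.mem_coe, Finset.mem_range, Set.mem_prod]
    constructor
    · exact fun h => ⟨h 0 (Nat.succ_pos _), fun i hi => h (i + 1) (Nat.succ_lt_succ hi)⟩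
    · rintro ⟨h0, h1⟩ i hi
      cases i with
      | zero => exact h0
      | succ i => exact h1 i (Nat.lt_of_succ_lt_succ hi)
  rw [hpi, hprod, Measure.map_apply hm (MeasurableSet.pi (Finset.countable_toSet _) fun i _ => ht' i),
    hpre, Measure.prod_prod, Measure.infinitePi_pi _ fun i _ => ht' _, Finset.prod_range_succ',
    mul_comm]

theorem measurePreserving_head_tail :
    MeasurePreserving (fun z : ℕ → A => (z 0, fun n => z (n + 1)))
      (Measure.infinitePi fun _ : ℕ => ρ) (ρ.prod (Measure.infinitePi fun _ : ℕ => ρ)) := by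
  have hm : Measurable (fun p n => Nat.casesOn n p.1 p.2 : A × (ℕ → A) → ℕ → A) := by
    refine measurable_pi_lambda _ fun n => ?_
    cases n with
    | zero => exact measurable_fst
    | succ n => exact (measurable_pi_apply n).comp measurable_snd
  have hm' : Measurable (fun z : ℕ → A => (z 0, fun n => z (n + 1))) :=
    (measurable_pi_apply 0).prodMk (measurable_pi_lambda _ fun n => measurable_pi_apply _)
  refine ⟨hm', ?_⟩
  nth_rewrite 1 [← infinitePi_map_cons ρ]
  rw [Measure.map_map hm' hm]
  exact Measure.map_id

theorem measurePreserving_tail :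
    MeasurePreserving (fun (z : ℕ → A) n => z (n + 1))
      (Measure.infinitePi fun _ : ℕ => ρ) (Measure.infinitePi fun _ : ℕ => ρ) :=
  measurePreserving_snd.comp (measurePreserving_head_tail ρ)

end HeadTail

theorem MeasureTheory.ae_ae_of_ae_prod_swap {X Y : Type*} [MeasurableSpace X] [MeasurableSpace Y]
    {μ : Measure X} {ν : Measure Y} [SFinite μ] [SFinite ν] {p : X × Y → Prop}
    (h : ∀ᵐ x ∂μ.prod ν, p x) : ∀ᵐ y ∂ν, ∀ᵐ x ∂μ, p (x, y) :=
  Measure.ae_ae_of_ae_prod (Measure.measurePreserving_swap.quasiMeasurePreserving.ae h)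

/-! ### The environment seen from the walk -/

namespace SitePercolation

variable {Γ : Type*} [Group Γ]

theorem walk_eq_mul (v : Γ) (z : ℕ → Γ) (n : ℕ) : walk v z n = v * walk 1 z n := by
  induction n with
  | zero => simp [walk]
  | succ n ih => simp only [walk, ih, mul_assoc]

section Skew

variable {Y : Type*} [MulAction Γ Y]

/-- The environment seen from a walk on `Γ`, together with the future increments of the walk. -/
def walkSkew (p : (ℕ → Γ) × Y) : (ℕ → Γ) × Y := (fun n => p.1 (n + 1), (p.1 0)⁻¹ • p.2)

/-- The walk multiplies increments on the right, so the inverse of its position composes the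
successive actions in the order in which the iteration applies them. -/
theorem walkSkew_iterate (n : ℕ) (p : (ℕ → Γ) × Y) :
    walkSkew^[n] p = (fun k => p.1 (k + n), (walk 1 p.1 n)⁻¹ • p.2) := by
  induction n with
  | zero => simp [walk]
  | succ n ih =>
    rw [Function.iterate_succ_apply', ih]
    simp only [walkSkew, walk, mul_inv_rev, mul_smul, Prod.mk.injEq, zero_add, and_true]
    funext k
    exact congrArg p.1 (by omega)

theorem birkhoffAverage_walkSkew (f : Y → ℝ) (N : ℕ) (p : (ℕ → Γ) × Y) :
    birkhoffAverage ℝ walkSkew (fun p => f p.2) N p =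
      (∑ n ∈ Finset.range N, f ((walk 1 p.1 n)⁻¹ • p.2)) / N := by
  simp only [birkhoffAverage, birkhoffSum, walkSkew_iterate, smul_eq_mul, inv_mul_eq_div]

variable [Countable Γ] [MeasurableSpace Γ] [DiscreteMeasurableSpace Γ] [MeasurableSpace Y]
  [MeasurableConstSMul Γ Y]

theorem measurable_inv_smul : Measurable fun p : Γ × Y => p.1⁻¹ • p.2 :=
  measurable_from_prod_countable_right fun g => measurable_const_smul g⁻¹

theorem measurePreserving_walkSkew (ρ : Measure Γ) [IsProbabilityMeasure ρ] (m : Measure Y)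
    [SFinite m] [SMulInvariantMeasure Γ Y m] :
    MeasurePreserving (walkSkew (Γ := Γ) (Y := Y))
      ((Measure.infinitePi fun _ : ℕ => ρ).prod m) ((Measure.infinitePi fun _ : ℕ => ρ).prod m) := by
  refine (measurePreserving_tail ρ).skew_product (g := fun z y => (z 0)⁻¹ • y) ?_ ?_
  · exact measurable_inv_smul.comp
      (((measurable_pi_apply 0).comp measurable_fst).prodMk measurable_snd)
  · exact Eventually.of_forall fun z => (measurePreserving_smul (z 0)⁻¹ m).map_eq

end Skew

end SitePercolation

/-! ### Invariant functions and `L²` identities -/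

section Invariant

variable {X : Type*} [MeasurableSpace X] {μ : Measure X} {T : X → X}

theorem MeasureTheory.MeasurePreserving.integral_comp_of_measurable
    (hT : MeasurePreserving T μ μ) {f : X → ℝ} (hf : Measurable f) :
    ∫ x, f (T x) ∂μ = ∫ x, f x ∂μ := by
  rw [← integral_map hT.measurable.aemeasurable hf.aestronglyMeasurable, hT.map_eq]

theorem ae_comp_iterate_eq (hT : MeasurePreserving T μ μ) {H : X → ℝ}
    (hH : (fun x => H (T x)) =ᵐ[μ] H) (n : ℕ) : (fun x => H (T^[n] x)) =ᵐ[μ] H := by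
  induction n with
  | zero => rfl
  | succ n ih =>
    have := hT.quasiMeasurePreserving.ae_eq_comp ih
    exact this.trans hH

variable [IsFiniteMeasure μ]

theorem integrable_mul_of_abs_le_one {u w : X → ℝ} (hu : Measurable u) (hw : Measurable w)
    (hu1 : ∀ x, |u x| ≤ 1) (hw1 : ∀ x, |w x| ≤ 1) : Integrable (fun x => u x * w x) μ := by
  refine Integrable.of_bound (hu.mul hw).aestronglyMeasurable 1 (Eventually.of_forall fun x => ?_)
  rw [Real.norm_eq_abs, abs_mul]
  exact mul_le_one₀ (hu1 x) (abs_nonneg _) (hw1 x)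

/-- Expanding the square, the two hypotheses make `∫ (u - w)²` vanish. -/
theorem ae_eq_of_integral_mul_self_eq {u w : X → ℝ} (hu : Measurable u) (hw : Measurable w)
    (hu1 : ∀ x, |u x| ≤ 1) (hw1 : ∀ x, |w x| ≤ 1)
    (h1 : ∫ x, u x * u x ∂μ = ∫ x, w x * w x ∂μ) (h2 : ∫ x, w x * u x ∂μ = ∫ x, w x * w x ∂μ) :
    ∀ᵐ x ∂μ, u x = w x := by
  have iuu := integrable_mul_of_abs_le_one (μ := μ) hu hu hu1 hu1
  have iwu := (integrable_mul_of_abs_le_one (μ := μ) hw hu hw1 hu1).const_mul 2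
  have iww := integrable_mul_of_abs_le_one (μ := μ) hw hw hw1 hw1
  have e : (fun x => (u x - w x) ^ 2) = fun x => u x * u x - 2 * (w x * u x) + w x * w x := by
    funext x; ring
  have iuw : Integrable (fun x => u x * u x - 2 * (w x * u x)) μ := iuu.sub iwu
  have hI : Integrable (fun x => (u x - w x) ^ 2) μ := by
    rw [e]; exact iuw.add iww
  have hz : ∫ x, (u x - w x) ^ 2 ∂μ = 0 := by
    rw [e, integral_add iuw iww, integral_sub iuu iwu, integral_const_mul, h1, h2]
    ring
  rw [integral_eq_zero_iff_of_nonneg (fun x => sq_nonneg _) hI] at hz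
  filter_upwards [hz] with x hx
  exact sub_eq_zero.1 (pow_eq_zero_iff two_ne_zero |>.1 hx)

/-- An invariant function has the same integral against `f` as against a limit of the Birkhoff
averages of `f`. -/
theorem integral_mul_birkhoffAverage_limit (hT : MeasurePreserving T μ μ) {F G H : X → ℝ}
    (hF : Measurable F) (hF1 : ∀ x, |F x| ≤ 1) (hH : Measurable H) (hH1 : ∀ x, |H x| ≤ 1)
    (hinv : (fun x => H (T x)) =ᵐ[μ] H)
    (hG : ∀ᵐ x ∂μ, Tendsto (fun n => birkhoffAverage ℝ T F n x) atTop (𝓝 (G x))) :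
    ∫ x, H x * G x ∂μ = ∫ x, H x * F x ∂μ := by
  have hFT : ∀ k, Measurable fun x => F (T^[k] x) := fun k => hF.comp (hT.measurable.iterate k)
  have hi : ∀ k, Integrable (fun x => H x * F (T^[k] x)) μ := fun k =>
    integrable_mul_of_abs_le_one hH (hFT k) hH1 fun x => hF1 _
  -- By invariance `H` may be replaced by `H ∘ T^[k]`, after which `T^[k]` is removed from the whole
  -- integrand by measure preservation.
  have hk : ∀ k, ∫ x, H x * F (T^[k] x) ∂μ = ∫ x, H x * F x ∂μ := by
    intro k
    have h1 : ∫ x, H x * F (T^[k] x) ∂μ = ∫ x, H (T^[k] x) * F (T^[k] x) ∂μ := by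
      refine integral_congr_ae ?_
      filter_upwards [ae_comp_iterate_eq hT hinv k] with x hx
      rw [hx]
    rw [h1]
    exact (hT.iterate k).integral_comp_of_measurable (hH.mul hF)
  have hN : ∀ N : ℕ, N ≠ 0 → ∫ x, H x * birkhoffAverage ℝ T F N x ∂μ = ∫ x, H x * F x ∂μ := by
    intro N hN0
    have : ∀ x, H x * birkhoffAverage ℝ T F N x =
        (N : ℝ)⁻¹ * ∑ k ∈ Finset.range N, H x * F (T^[k] x) := by
      intro x
      rw [← Finset.mul_sum, birkhoffAverage, birkhoffSum, smul_eq_mul]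
      ring
    simp_rw [this]
    rw [integral_const_mul, integral_finsetSum _ fun k _ => hi k]
    simp_rw [hk]
    rw [Finset.sum_const, Finset.card_range, nsmul_eq_mul, ← mul_assoc,
      inv_mul_cancel₀ (Nat.cast_ne_zero.2 hN0), one_mul]
  have hlim : Tendsto (fun N : ℕ => ∫ x, H x * birkhoffAverage ℝ T F N x ∂μ) atTop
      (𝓝 (∫ x, H x * G x ∂μ)) := by
    refine tendsto_integral_of_dominated_convergence (fun _ => 1)
      (fun N => (hH.mul (measurable_birkhoffAverage hT.measurable hF N)).aestronglyMeasurable)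
      (integrable_const 1) (fun N => Eventually.of_forall fun x => ?_) ?_
    · rw [Real.norm_eq_abs, abs_mul]
      exact mul_le_one₀ (hH1 x) (abs_nonneg _) (abs_birkhoffAverage_le hF1 N x)
    · filter_upwards [hG] with x hx
      exact hx.const_mul _
  refine tendsto_nhds_unique hlim (tendsto_const_nhds.congr' ?_)
  filter_upwards [eventually_ne_atTop 0] with N hN0
  exact (hN N hN0).symm

end Invariant

/-! ### Walk averages of a stationary environment -/

namespace SitePercolation

variable {Γ : Type*} [Group Γ] [Countable Γ] [MeasurableSpace Γ] [DiscreteMeasurableSpace Γ]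
  {Y : Type*} [MulAction Γ Y] [MeasurableSpace Y] [MeasurableConstSMul Γ Y]

/-- Averaging the invariant limit over the walk yields a function of the environment alone, which
is harmonic, hence invariant under the steps of the walk. -/
theorem ae_walkSkew_integral_eq (ρ : Measure Γ) [IsProbabilityMeasure ρ] (m : Measure Y)
    [IsProbabilityMeasure m] [SMulInvariantMeasure Γ Y m] {G : (ℕ → Γ) × Y → ℝ}
    (hG : Measurable G) (hG1 : ∀ p, |G p| ≤ 1)
    (hinv : ∀ᵐ p ∂(Measure.infinitePi fun _ : ℕ => ρ).prod m, G (walkSkew p) = G p) :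
    ∀ᵐ p ∂(Measure.infinitePi fun _ : ℕ => ρ).prod m,
      ∫ z, G (z, (walkSkew p).2) ∂(Measure.infinitePi fun _ : ℕ => ρ) =
        ∫ z, G (z, p.2) ∂(Measure.infinitePi fun _ : ℕ => ρ) := by
  set P : Measure (ℕ → Γ) := Measure.infinitePi fun _ : ℕ => ρ with hP
  let h : Y → ℝ := fun y => ∫ z, G (z, y) ∂P
  have hTm : MeasurePreserving walkSkew (P.prod m) (P.prod m) := measurePreserving_walkSkew ρ m
  have hh : Measurable h := (hG.stronglyMeasurable.integral_prod_left').measurable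
  have hh1 : ∀ y, |h y| ≤ 1 := by
    intro y
    have := norm_integral_le_of_norm_le_const (μ := P) (f := fun z => G (z, y)) (C := 1)
      (Eventually.of_forall fun z => hG1 _)
    simpa using this
  have hK : Measurable fun p : (ℕ → Γ) × Y => h (walkSkew p).2 :=
    hh.comp (measurable_snd.comp hTm.measurable)
  -- Harmonicity: use the invariance of `G`, then separate the first increment from the independent
  -- rest of the sequence.
  have harm : ∀ᵐ y ∂m, h y = ∫ z, h ((z 0)⁻¹ • y) ∂P := by
    filter_upwards [ae_ae_of_ae_prod_swap hinv] with y hy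
    have hmy : Measurable fun q : Γ × (ℕ → Γ) => G (q.2, q.1⁻¹ • y) :=
      hG.comp (measurable_snd.prodMk
        (measurable_inv_smul.comp (measurable_fst.prodMk measurable_const)))
    have e1 : h y = ∫ z, G (fun n => z (n + 1), (z 0)⁻¹ • y) ∂P :=
      integral_congr_ae (by filter_upwards [hy] with z hz using hz.symm)
    have e2 : ∫ z, G (fun n => z (n + 1), (z 0)⁻¹ • y) ∂P =
        ∫ q, G (q.2, q.1⁻¹ • y) ∂(ρ.prod P) := by
      have hht := measurePreserving_head_tail ρ
      rw [← hht.map_eq, integral_map hht.measurable.aemeasurable hmy.aestronglyMeasurable]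
    have e3 : ∫ q, G (q.2, q.1⁻¹ • y) ∂(ρ.prod P) = ∫ s, h (s⁻¹ • y) ∂ρ := by
      rw [integral_prod]
      exact Integrable.of_bound hmy.aestronglyMeasurable 1 (Eventually.of_forall fun q => hG1 _)
    have e4 : ∫ s, h (s⁻¹ • y) ∂ρ = ∫ z, h ((z 0)⁻¹ • y) ∂P := by
      have hev := measurePreserving_eval_infinitePi (fun _ : ℕ => ρ) 0
      conv_lhs => rw [← hev.map_eq]
      rw [integral_map hev.measurable.aemeasurable
        (Measurable.of_discrete (f := fun s : Γ => h (s⁻¹ • y))).aestronglyMeasurable]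
    rw [e1, e2, e3, e4]
  have hhs : Measurable fun p : (ℕ → Γ) × Y => h p.2 := hh.comp measurable_snd
  have hhs1 : ∀ p : (ℕ → Γ) × Y, |h p.2| ≤ 1 := fun p => hh1 p.2
  -- A stationary harmonic function has no variance along a step: its `L²` norm after the step is
  -- unchanged, and by harmonicity its product with the stepped function also integrates to `∫ h²`.
  refine ae_eq_of_integral_mul_self_eq hK hhs (fun p => hh1 _) hhs1
    (hTm.integral_comp_of_measurable (hhs.mul hhs)) ?_
  rw [integral_prod_symm _ (integrable_mul_of_abs_le_one hhs hK hhs1 fun p => hh1 _),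
    integral_prod_symm _ (integrable_mul_of_abs_le_one hhs hhs hhs1 hhs1)]
  refine integral_congr_ae ?_
  filter_upwards [harm] with y hy
  simp only [walkSkew]
  rw [integral_const_mul, ← hy]
  simp

/-- For a random walk whose steps generate the group, the averages of a bounded observable of a
stationary environment along the walk converge to a limit that depends on the environment only. -/
theorem ae_exists_tendsto_walk_average (ρ : Measure Γ) [IsProbabilityMeasure ρ]
    (hρ : Subgroup.closure {s : Γ | ρ {s} ≠ 0} = ⊤) (m : Measure Y)
    [IsProbabilityMeasure m] [SMulInvariantMeasure Γ Y m] {f : Y → ℝ} (hf : Measurable f)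
    (hf0 : ∀ y, 0 ≤ f y) (hf1 : ∀ y, f y ≤ 1) :
    ∀ᵐ y ∂m, ∃ α, ∀ v : Γ, ∀ᵐ z ∂(Measure.infinitePi fun _ : ℕ => ρ),
      Tendsto (fun N : ℕ => (∑ n ∈ Finset.range N, f ((walk v z n)⁻¹ • y)) / N) atTop (𝓝 α) := by
  set P : Measure (ℕ → Γ) := Measure.infinitePi fun _ : ℕ => ρ with hP
  let F : (ℕ → Γ) × Y → ℝ := fun p => f p.2
  have hF : Measurable F := hf.comp measurable_snd
  have hFabs : ∀ p, |F p| ≤ 1 := fun p => abs_le.2 ⟨by linarith [hf0 p.2], hf1 p.2⟩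
  have hTm : MeasurePreserving walkSkew (P.prod m) (P.prod m) := measurePreserving_walkSkew ρ m
  have hconv := ae_exists_tendsto_birkhoffAverage hTm hF hFabs
  obtain ⟨G₀, hG₀, hlim₀⟩ := measurable_limit_of_tendsto_metrizable_ae
    (fun n => (measurable_birkhoffAverage hTm.measurable hF n).aemeasurable) hconv
  -- Clamping makes the bound hold everywhere and changes the limit only on a null set.
  let G : (ℕ → Γ) × Y → ℝ := fun p => max (-1) (min 1 (G₀ p))
  have hG : Measurable G := measurable_const.max (measurable_const.min hG₀)
  have hG1 : ∀ p, |G p| ≤ 1 := fun p =>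
    abs_le.2 ⟨le_max_left _ _, max_le (by norm_num) (min_le_left _ _)⟩
  have hlim : ∀ᵐ p ∂(P.prod m),
      Tendsto (fun N => birkhoffAverage ℝ walkSkew F N p) atTop (𝓝 (G p)) := by
    filter_upwards [hlim₀] with p hp
    have h1 : G₀ p ≤ 1 := le_of_tendsto' hp fun N => (abs_le.1 (abs_birkhoffAverage_le hFabs N p)).2
    have h2 : -1 ≤ G₀ p := ge_of_tendsto' hp fun N => (abs_le.1 (abs_birkhoffAverage_le hFabs N p)).1
    have : G p = G₀ p := by
      change max (-1) (min 1 (G₀ p)) = G₀ p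
      rw [min_eq_right h1, max_eq_right h2]
    rwa [this]
  have hinv : ∀ᵐ p ∂(P.prod m), G (walkSkew p) = G p := by
    filter_upwards [hlim, hTm.quasiMeasurePreserving.ae hlim] with p h1 h2
    have h3 := tendsto_birkhoffAverage_apply_sub_birkhoffAverage ℝ (f := walkSkew) (g := F) (x := p)
      (isBounded_iff_forall_norm_le.2 ⟨1, by rintro _ ⟨n, rfl⟩; exact hFabs _⟩)
    exact sub_eq_zero.1 (tendsto_nhds_unique (h2.sub h1) h3)
  let h : Y → ℝ := fun y => ∫ z, G (z, y) ∂P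
  have hh : Measurable h := (hG.stronglyMeasurable.integral_prod_left').measurable
  have hh1 : ∀ y, |h y| ≤ 1 := by
    intro y
    have := norm_integral_le_of_norm_le_const (μ := P) (f := fun z => G (z, y)) (C := 1)
      (Eventually.of_forall fun z => hG1 _)
    simpa using this
  have hhinv : ∀ᵐ p ∂(P.prod m), h (walkSkew p).2 = h p.2 :=
    ae_walkSkew_integral_eq ρ m hG hG1 hinv
  have j1 := integral_mul_birkhoffAverage_limit hTm hF hFabs hG hG1 hinv hlim
  have j2 := integral_mul_birkhoffAverage_limit hTm hF hFabs (hh.comp measurable_snd)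
    (fun p => hh1 p.2) hhinv hlim
  have hhs : Measurable fun p : (ℕ → Γ) × Y => h p.2 := hh.comp measurable_snd
  have hhs1 : ∀ p : (ℕ → Γ) × Y, |h p.2| ≤ 1 := fun p => hh1 p.2
  have j3 : ∫ p, h p.2 * G p ∂(P.prod m) = ∫ p, h p.2 * h p.2 ∂(P.prod m) := by
    rw [integral_prod_symm _ (integrable_mul_of_abs_le_one hhs hG hhs1 hG1),
      integral_prod_symm _ (integrable_mul_of_abs_le_one hhs hhs hhs1 hhs1)]
    refine integral_congr_ae (Eventually.of_forall fun y => ?_)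
    simp only
    rw [integral_const_mul]
    simp [h]
  have j4 : ∫ p, G p * F p ∂(P.prod m) = ∫ p, h p.2 * F p ∂(P.prod m) := by
    rw [integral_prod_symm _ (integrable_mul_of_abs_le_one hG hF hG1 hFabs),
      integral_prod_symm _ (integrable_mul_of_abs_le_one hhs hF hhs1 hFabs)]
    refine integral_congr_ae (Eventually.of_forall fun y => ?_)
    simp only [F]
    rw [integral_mul_const]
    simp [h]
  -- Here `h` is the conditional expectation of `G` given the environment. As `F` depends on the
  -- environment only and both `G` and `h` are invariant, `∫ G² = ∫ GF = ∫ hF = ∫ hG = ∫ h²`.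
  have hGh : ∀ᵐ p ∂(P.prod m), G p = h p.2 := by
    simp only [Function.comp_apply] at j2
    exact ae_eq_of_integral_mul_self_eq hG hhs hG1 hhs1 (by rw [j1, j4, ← j2, j3]) j3
  have hstep : ∀ s ∈ {s : Γ | ρ {s} ≠ 0}, ∀ᵐ y ∂m, h (s⁻¹ • y) = h y := by
    intro s hs
    -- A step of positive mass is the first increment with positive probability, hence for some `z`
    -- outside the exceptional null set.
    have h1 : ∀ᵐ z ∂P, ∀ᵐ y ∂m, h ((z 0)⁻¹ • y) = h y := Measure.ae_ae_of_ae_prod hhinv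
    have hev := measurePreserving_eval_infinitePi (fun _ : ℕ => ρ) 0
    have h2 : P {z | z 0 = s} ≠ 0 := by
      have := hev.measure_preimage (MeasurableSet.of_discrete (s := {s})).nullMeasurableSet
      have h3 : P {z | z 0 = s} = ρ {s} := this
      rw [h3]; exact hs
    obtain ⟨z, hz, hzs⟩ : ∃ z : ℕ → Γ, (∀ᵐ y ∂m, h ((z 0)⁻¹ • y) = h y) ∧ z 0 = s := by
      by_contra hcon
      push Not at hcon
      refine h2 (measure_mono_null (fun z hz => ?_) h1)
      exact fun hz' => hcon z hz' hz
    rwa [hzs] at hz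
  have hall : ∀ g : Γ, ∀ᵐ y ∂m, h (g⁻¹ • y) = h y := by
    intro g
    have hg : g ∈ Subgroup.closure {s : Γ | ρ {s} ≠ 0} := hρ ▸ Subgroup.mem_top g
    induction hg using Subgroup.closure_induction with
    | mem s hs => exact hstep s hs
    | one => simp
    | mul a b _ _ iha ihb =>
      filter_upwards [iha, tendsto_smul_ae m a⁻¹ ihb] with y h1 h2
      have h2' : h (b⁻¹ • a⁻¹ • y) = h (a⁻¹ • y) := h2
      rw [mul_inv_rev, mul_smul, h2', h1]
    | inv a _ iha =>
      filter_upwards [tendsto_smul_ae m a iha] with y h1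
      have h1' : h (a⁻¹ • a • y) = h (a • y) := h1
      rw [inv_inv, ← h1', inv_smul_smul]
  have hfin : ∀ᵐ y ∂m, ∀ᵐ z ∂P,
      Tendsto (fun N => birkhoffAverage ℝ walkSkew F N (z, y)) atTop (𝓝 (h y)) := by
    have : ∀ᵐ p ∂(P.prod m),
        Tendsto (fun N => birkhoffAverage ℝ walkSkew F N p) atTop (𝓝 (h p.2)) := by
      filter_upwards [hlim, hGh] with p h1 h2
      rwa [h2] at h1
    exact ae_ae_of_ae_prod_swap this
  -- A walk from `v` in the environment `y` is a walk from 1 in `v⁻¹ • y`, where the limit `h` takes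
  -- the same value.
  filter_upwards [ae_all_iff.2 hall, ae_all_iff.2 fun g : Γ => tendsto_smul_ae m g⁻¹ hfin]
    with y h1 h2
  refine ⟨h y, fun v => ?_⟩
  have h3 : ∀ᵐ z ∂P,
      Tendsto (fun N => birkhoffAverage ℝ walkSkew F N (z, v⁻¹ • y)) atTop (𝓝 (h (v⁻¹ • y))) := h2 v
  filter_upwards [h3] with z hz
  rw [h1 v] at hz
  refine hz.congr fun N => ?_
  rw [birkhoffAverage_walkSkew]
  congr 1
  refine Finset.sum_congr rfl fun n _ => ?_
  rw [walk_eq_mul v, mul_inv_rev, mul_smul]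

end SitePercolation

/-! ### Ergodicity of mixtures -/

open scoped symmDiff

section

variable {Γ X Y : Type*} [Group Γ] [MulAction Γ X] [MeasurableSpace X]
  [MulAction Γ Y] [MeasurableSpace Y]

theorem exists_ae_eq_const_of_ergodicSMul {μ : Measure X} [ErgodicSMul Γ X μ] {φ : X → ENNReal}
    (hφ : Measurable φ) (h : ∀ g : Γ, ∀ᵐ x ∂μ, φ (g • x) = φ x) : ∃ c, ∀ᵐ x ∂μ, φ x = c := by
  refine exists_eventuallyEq_const_of_forall_separating (f := φ) MeasurableSet fun U hU => ?_
  have := aeconst_of_forall_preimage_smul_ae_eq Γ (μ := μ) (hφ hU).nullMeasurableSet fun g => by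
    filter_upwards [h g] with x hx
    exact propext (show φ (g • x) ∈ U ↔ φ x ∈ U by rw [hx])
  exact eventuallyConst_pred.1 this

variable [MeasurableConstSMul Γ X] [MeasurableConstSMul Γ Y]

theorem smulInvariantMeasure_bind {μ : Measure X} [SMulInvariantMeasure Γ X μ]
    {κ : X → Measure Y} (hκm : Measurable κ) (hκ : ∀ (g : Γ) x, κ (g • x) = (κ x).map (g • ·)) :
    SMulInvariantMeasure Γ Y (μ.bind κ) := by
  refine ⟨fun g s hs => ?_⟩
  rw [Measure.bind_apply hs hκm.aemeasurable,
    Measure.bind_apply (measurable_const_smul g hs) hκm.aemeasurable]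
  have : ∀ x, κ x ((g • ·) ⁻¹' s) = κ (g • x) s := fun x => by
    rw [hκ, Measure.map_apply (measurable_const_smul g) hs]
  simp_rw [this]
  exact (measurePreserving_smul g μ).lintegral_comp (Measure.measurable_coe hs |>.comp hκm)

/-- As `A = A'` almost everywhere, `P(A) = P(A ∩ A')`, which is close to `P(B ∩ B') = P(B) P(B')`
and so to `P(A)²`. Each symmetric difference is paid twice, once for the intersection and once for
the product. -/
theorem abs_real_sub_mul_le {P : Measure Y} [IsProbabilityMeasure P] {A A' B B' : Set Y}
    (hA : MeasurableSet A) (hA' : MeasurableSet A') (hB : MeasurableSet B)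
    (hB' : MeasurableSet B') (h : P (B ∩ B') = P B * P B') (hAA : A =ᵐ[P] A') :
    |P.real A - P.real A * P.real A| ≤ 2 * (P.real (A ∆ B) + P.real (A' ∆ B')) := by
  have h1 := abs_measureReal_sub_le_measureReal_symmDiff (μ := P) hA.nullMeasurableSet
    hB.nullMeasurableSet
  have h2 := abs_measureReal_sub_le_measureReal_symmDiff (μ := P) hA'.nullMeasurableSet
    hB'.nullMeasurableSet
  have h3 := abs_measureReal_sub_le_measureReal_symmDiff (μ := P)
    (hA.inter hA').nullMeasurableSet (hB.inter hB').nullMeasurableSet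
  have h4 : P.real ((A ∩ A') ∆ (B ∩ B')) ≤ P.real (A ∆ B) + P.real (A' ∆ B') := by
    refine (measureReal_mono ?_).trans (measureReal_union_le _ _)
    intro y
    simp only [Set.mem_symmDiff, Set.mem_inter_iff, Set.mem_union]
    tauto
  have e1 : P.real A' = P.real A := (measureReal_congr hAA).symm
  have e2 : P.real (A ∩ A') = P.real A := by
    refine measureReal_congr ?_
    filter_upwards [hAA] with y hy
    have hy' : (y ∈ A) = (y ∈ A') := hy
    exact propext (show y ∈ A ∩ A' ↔ y ∈ A by simp [← hy'])
  have e3 : P.real (B ∩ B') = P.real B * P.real B' := by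
    simp only [measureReal_def, h, ENNReal.toReal_mul]
  rw [e1] at h2
  rw [e2, e3] at h3
  have hA1 : P.real A ≤ 1 := measureReal_le_one
  have hB1 : P.real B ≤ 1 := measureReal_le_one
  have hA0 : 0 ≤ P.real A := measureReal_nonneg
  have hB0 : 0 ≤ P.real B := measureReal_nonneg
  have key : P.real A - P.real A * P.real A = (P.real A - P.real B * P.real B') -
      (P.real A - P.real B) * P.real A - P.real B * (P.real A - P.real B') := by ring
  rw [key]
  have k1 : |(P.real A - P.real B) * P.real A| ≤ P.real (A ∆ B) := by
    rw [abs_mul, abs_of_nonneg hA0]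
    exact (mul_le_of_le_one_right (abs_nonneg _) hA1).trans h1
  have k2 : |P.real B * (P.real A - P.real B')| ≤ P.real (A' ∆ B') := by
    rw [abs_mul, abs_of_nonneg hB0]
    exact (mul_le_of_le_one_left (abs_nonneg _) hB1).trans h2
  have t1 := abs_sub (P.real A - P.real B * P.real B' - (P.real A - P.real B) * P.real A)
    (P.real B * (P.real A - P.real B'))
  have t2 := abs_sub (P.real A - P.real B * P.real B') ((P.real A - P.real B) * P.real A)
  linarith

/-- A mixture of an equivariant family of laws over an ergodic law is ergodic, as soon as every
event of a generating algebra is, with high conditional probability, conditionally independent of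
one of its translates. -/
theorem IsErgodicLaw.bind {μ : Measure X} (hμ : IsErgodicLaw Γ μ) {κ : X → Measure Y}
    (hκm : Measurable κ) (hprob : ∀ x, IsProbabilityMeasure (κ x))
    (hκ : ∀ (g : Γ) x, κ (g • x) = (κ x).map (g • ·)) {𝒜 : Set (Set Y)} (h𝒜 : IsSetAlgebra 𝒜)
    (hgen : ‹MeasurableSpace Y› = MeasurableSpace.generateFrom 𝒜)
    (hdec : ∀ B ∈ 𝒜, ∀ ε : ENNReal, 0 < ε → ∃ g : Γ,
      μ {x | ¬ κ x (B ∩ (g • ·) ⁻¹' B) = κ x B * κ x ((g • ·) ⁻¹' B)} ≤ ε) :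
    IsErgodicLaw Γ (μ.bind κ) := by
  have := hμ.isProbabilityMeasure
  have := hμ.ergodicSMul
  have hPr : IsProbabilityMeasure (μ.bind κ) := by
    refine ⟨?_⟩
    rw [Measure.bind_apply .univ hκm.aemeasurable]
    simp
  have hinv : SMulInvariantMeasure Γ Y (μ.bind κ) := smulInvariantMeasure_bind hκm hκ
  refine ⟨hPr, ⟨fun {s} hs hsinv => ?_⟩⟩
  -- Invariance modulo the mixture is invariance modulo almost every component.
  have hsinv' : ∀ g : Γ, ∀ᵐ x ∂μ, s =ᵐ[κ x] (g • ·) ⁻¹' s := fun g =>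
    Measure.ae_ae_of_ae_bind hκm.aemeasurable (hsinv g).symm
  obtain ⟨c, hc⟩ := exists_ae_eq_const_of_ergodicSMul (Γ := Γ) (μ := μ) (φ := fun x => κ x s)
    (Measure.measurable_coe hs |>.comp hκm) (fun g => by
      filter_upwards [hsinv' g] with x hx
      rw [hκ, Measure.map_apply (measurable_const_smul g) hs]
      exact (measure_congr hx).symm)
  have hsc : μ.bind κ s = c := by
    rw [Measure.bind_apply hs hκm.aemeasurable, lintegral_congr_ae hc]
    simp
  have hctop : c ≠ ⊤ := hsc ▸ measure_ne_top _ _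
  have hdense := Measure.MeasureDense.of_generateFrom_isSetAlgebra_finite (μ.bind κ) h𝒜 hgen
  have hle : ∀ δ : ℝ, 0 < δ → ENNReal.ofReal |c.toReal - c.toReal * c.toReal| ≤
      5 * ENNReal.ofReal δ := by
    intro δ hδ
    obtain ⟨B, hB, hsB⟩ := hdense.approx s hs (measure_ne_top _ _) δ hδ
    have hBm := hdense.measurable B hB
    obtain ⟨g, hg⟩ := hdec B hB (ENNReal.ofReal δ) (ENNReal.ofReal_pos.2 hδ)
    set bad : Set X := {x | ¬ κ x (B ∩ (g • ·) ⁻¹' B) = κ x B * κ x ((g • ·) ⁻¹' B)}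
    let s' : Set Y := (g • ·) ⁻¹' s
    let B' : Set Y := (g • ·) ⁻¹' B
    have hs' : MeasurableSet s' := measurable_const_smul g hs
    have hB' : MeasurableSet B' := measurable_const_smul g hBm
    have hc01 : |c.toReal - c.toReal * c.toReal| ≤ 1 := by
      have h0 : 0 ≤ c.toReal := ENNReal.toReal_nonneg
      have h1 : c.toReal ≤ 1 := by
        rw [← hsc]; exact measureReal_le_one
      rw [abs_le]; constructor <;> nlinarith
    -- On `bad` the trivial bound 1 is used; elsewhere conditional independence gives the first
    -- term. Integration then yields `2(δ + δ) + δ = 5δ`.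
    have hpt : ∀ᵐ x ∂μ, ENNReal.ofReal |c.toReal - c.toReal * c.toReal| ≤
        2 * (κ x (s ∆ B) + κ x (s' ∆ B')) + bad.indicator (fun _ => 1) x := by
      filter_upwards [hc, hsinv' g] with x hx hxs
      by_cases hb : x ∈ bad
      · rw [Set.indicator_of_mem hb]
        refine le_add_left ?_
        rw [← ENNReal.ofReal_one]
        exact ENNReal.ofReal_le_ofReal hc01
      · have hind : κ x (B ∩ B') = κ x B * κ x B' := not_not.1 hb
        have := abs_real_sub_mul_le hs hs' hBm hB' hind hxs
        rw [Set.indicator_of_notMem hb, add_zero]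
        have e : (κ x).real s = c.toReal := by rw [measureReal_def, hx]
        rw [e] at this
        refine (ENNReal.ofReal_le_ofReal this).trans_eq ?_
        rw [ENNReal.ofReal_mul zero_le_two, ENNReal.ofReal_add measureReal_nonneg measureReal_nonneg,
          ofReal_measureReal, ofReal_measureReal, ENNReal.ofReal_ofNat]
    have hd : ∫⁻ x, κ x (s ∆ B) ∂μ ≤ ENNReal.ofReal δ := by
      rw [← Measure.bind_apply (hs.symmDiff hBm) hκm.aemeasurable]
      exact hsB.le
    have hd' : ∫⁻ x, κ x (s' ∆ B') ∂μ ≤ ENNReal.ofReal δ := by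
      rw [← Measure.bind_apply (hs'.symmDiff hB') hκm.aemeasurable]
      have : s' ∆ B' = (g • ·) ⁻¹' (s ∆ B) := rfl
      rw [this, measure_preimage_smul_of_nullMeasurableSet (hs.symmDiff hBm).nullMeasurableSet]
      exact hsB.le
    have hm1 : Measurable fun x => κ x (s ∆ B) :=
      Measure.measurable_coe (hs.symmDiff hBm) |>.comp hκm
    have hm2 : Measurable fun x => κ x (s' ∆ B') :=
      Measure.measurable_coe (hs'.symmDiff hB') |>.comp hκm
    have hm3 : Measurable fun x => κ x (s ∆ B) + κ x (s' ∆ B') := hm1.add hm2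
    calc ENNReal.ofReal |c.toReal - c.toReal * c.toReal|
        = ∫⁻ _, ENNReal.ofReal |c.toReal - c.toReal * c.toReal| ∂μ := by simp
      _ ≤ ∫⁻ x, (2 * (κ x (s ∆ B) + κ x (s' ∆ B')) + bad.indicator (fun _ => 1) x) ∂μ :=
          lintegral_mono_ae hpt
      _ = 2 * (∫⁻ x, κ x (s ∆ B) ∂μ + ∫⁻ x, κ x (s' ∆ B') ∂μ) +
          ∫⁻ x, bad.indicator (fun _ => 1) x ∂μ := by
          rw [lintegral_add_left (hm3.const_mul 2), lintegral_const_mul _ hm3,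
            lintegral_add_left hm1]
      _ ≤ 2 * (ENNReal.ofReal δ + ENNReal.ofReal δ) + ENNReal.ofReal δ := by
          gcongr
          exact (lintegral_indicator_one_le bad).trans hg
      _ = 5 * ENNReal.ofReal δ := by ring
  have hzero : c.toReal - c.toReal * c.toReal = 0 := by
    by_contra hne
    have hpos : 0 < |c.toReal - c.toReal * c.toReal| := abs_pos.2 hne
    -- With this `δ` the bound `5δ` is half of the left-hand side.
    have := hle (|c.toReal - c.toReal * c.toReal| / 10) (by positivity)
    rw [show (5 : ENNReal) = ENNReal.ofReal 5 by simp, ← ENNReal.ofReal_mul (by norm_num),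
      ENNReal.ofReal_le_ofReal_iff (by positivity)] at this
    linarith
  have hc' : c.toReal = 0 ∨ c.toReal = 1 := by
    have : c.toReal * (1 - c.toReal) = 0 := by linarith
    rcases mul_eq_zero.1 this with h | h
    · exact Or.inl h
    · exact Or.inr (by linarith)
  rw [eventuallyConst_set']
  rcases hc' with h | h
  · left
    rw [ae_eq_empty, hsc]
    exact (ENNReal.toReal_eq_zero_iff c).1 h |>.resolve_right hctop
  · right
    rw [ae_eq_univ, prob_compl_eq_zero_iff hs, hsc]
    exact (ENNReal.toReal_eq_one_iff c).1 h

end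

/-! ### Translations and independence under images and products -/

instance SiteConfig.instMeasurableConstSMul (Γ : Type*) [Group Γ] :
    MeasurableConstSMul Γ (SiteConfig Γ) :=
  ⟨fun g => measurable_pi_lambda _ fun v => measurable_pi_apply (g⁻¹ * v)⟩

theorem SiteConfig.smul_apply {Γ : Type*} [Group Γ] (g : Γ) (ω : SiteConfig Γ) (v : Γ) :
    (g • ω) v = ω (g⁻¹ * v) := rfl

theorem ProbabilityTheory.IndepFun.map_measure {A B C D : Type*} [MeasurableSpace A]
    [MeasurableSpace B] [MeasurableSpace C] [MeasurableSpace D] {P : Measure A} {φ : A → B}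
    {f : B → C} {g : B → D} (hφ : Measurable φ) (hf : Measurable f) (hg : Measurable g)
    (h : IndepFun (f ∘ φ) (g ∘ φ) P) : IndepFun f g (P.map φ) := by
  rw [indepFun_iff_measure_inter_preimage_eq_mul] at h ⊢
  intro s t hs ht
  rw [Measure.map_apply hφ ((hf hs).inter (hg ht)), Measure.map_apply hφ (hf hs),
    Measure.map_apply hφ (hg ht)]
  exact h s t hs ht

/-- The joint law is a product of laws of independent pairs, which regroups into a product of two
product laws. -/
theorem ProbabilityTheory.IndepFun.pi {ι A B C : Type*} [Fintype ι] [MeasurableSpace A]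
    [MeasurableSpace B] [MeasurableSpace C] {P : ι → Measure A} [∀ i, IsProbabilityMeasure (P i)]
    {f : A → B} {g : A → C} (hf : Measurable f) (hg : Measurable g)
    (h : ∀ i, IndepFun f g (P i)) :
    IndepFun (fun (y : ι → A) i => f (y i)) (fun (y : ι → A) i => g (y i)) (Measure.pi P) := by
  have hfp : ∀ i, IsProbabilityMeasure ((P i).map f) := fun i =>
    Measure.isProbabilityMeasure_map hf.aemeasurable
  have hgp : ∀ i, IsProbabilityMeasure ((P i).map g) := fun i =>
    Measure.isProbabilityMeasure_map hg.aemeasurable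
  have hfgp : ∀ i, IsProbabilityMeasure ((P i).map fun a => (f a, g a)) := fun i =>
    Measure.isProbabilityMeasure_map (hf.prodMk hg).aemeasurable
  have hf' : Measurable fun (y : ι → A) i => f (y i) := by fun_prop
  have hg' : Measurable fun (y : ι → A) i => g (y i) := by fun_prop
  rw [indepFun_iff_map_prod_eq_prod_map_map hf'.aemeasurable hg'.aemeasurable]
  have e1 : (Measure.pi P).map (fun (y : ι → A) i => (f (y i), g (y i))) =
      Measure.pi fun i => ((P i).map f).prod ((P i).map g) := by
    rw [Measure.pi_map_pi (f := fun _ a => (f a, g a)) fun i => (hf.prodMk hg).aemeasurable]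
    congr 1
    funext i
    exact (indepFun_iff_map_prod_eq_prod_map_map hf.aemeasurable hg.aemeasurable).1 (h i)
  have e2 := (measurePreserving_arrowProdEquivProdArrow B C ι (fun i => (P i).map f)
    (fun i => (P i).map g)).map_eq
  rw [← e1, Measure.map_map (MeasurableEquiv.measurable _) (by fun_prop)] at e2
  rw [Measure.pi_map_pi (f := fun _ => f) fun i => hf.aemeasurable,
    Measure.pi_map_pi (f := fun _ => g) fun i => hg.aemeasurable, ← e2]
  rfl

/-! ### Independence and equivariance of the thinning -/

namespace SitePercolation

section

variable {V : Type*} (G : SimpleGraph V)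

theorem measurable_retain (ω : SiteConfig V) : Measurable (retain G ω) := by
  refine measurable_pi_lambda _ fun v => ?_
  by_cases h : ω v = true
  · simpa [retain, h] using measurable_pi_apply _
  · simp [retain, h]

instance isProbabilityMeasure_thinLaw (q : I) (ω : SiteConfig V) :
    IsProbabilityMeasure (thinLaw G q ω) :=
  Measure.isProbabilityMeasure_map (measurable_retain G ω).aemeasurable

instance isProbabilityMeasure_thinned [Countable V] (q : I) (μ : Measure (SiteConfig V))
    [IsProbabilityMeasure μ] : IsProbabilityMeasure (thinned G q μ) := by
  refine ⟨?_⟩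
  rw [thinned, Measure.bind_apply .univ (measurable_thinLaw G q).aemeasurable]
  simp

/-- Under the thinning law, the restrictions to two finite sets that are not connected to each
other are independent. -/
theorem indepFun_restrict_thinLaw (q : I) (ω : SiteConfig V) (K L : Finset V)
    (h : ∀ x ∈ K, ∀ y ∈ L, ¬ SameCluster G ω x y) :
    IndepFun (fun (η : SiteConfig V) (v : K) => η v) (fun (η : SiteConfig V) (v : L) => η v)
      (thinLaw G q ω) := by
  classical
  -- The thinned configuration on `K` is a function `φ K` of the coins of the components meeting
  -- `K`; the hypothesis makes these components disjoint from those meeting `L`.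
  let comps : Finset V → Finset (openGraph G ω).ConnectedComponent := fun K =>
    (Finset.univ : Finset {v : K // ω v = true}).image
      fun v => (openGraph G ω).connectedComponentMk ⟨v.1, v.2⟩
  have hmem : ∀ (K : Finset V) (v : K) (hv : ω v = true),
      (openGraph G ω).connectedComponentMk ⟨v, hv⟩ ∈ comps K := fun K v hv =>
    Finset.mem_image.2 ⟨⟨v, hv⟩, Finset.mem_univ _, rfl⟩
  have hdisj : Disjoint (comps K) (comps L) := by
    rw [Finset.disjoint_left]
    intro c hc hc'
    obtain ⟨x, -, rfl⟩ := Finset.mem_image.1 hc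
    obtain ⟨y, -, hy⟩ := Finset.mem_image.1 hc'
    exact h x.1 x.1.2 y.1 y.1.2
      ⟨x.2, y.2, SimpleGraph.ConnectedComponent.exact hy.symm⟩
  have hr : ∀ K : Finset V, Measurable fun (η : SiteConfig V) (v : K) => η v := fun K =>
    measurable_pi_lambda _ fun v => measurable_pi_apply _
  refine IndepFun.map_measure (measurable_retain G ω) (hr K) (hr L) ?_
  have hind := (iIndepFun_infinitePi (P := fun _ : (openGraph G ω).ConnectedComponent =>
    bernoulliMeasure true false q) (X := fun _ b => b) (fun _ => measurable_id)).indepFun_finset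
      (comps K) (comps L) hdisj (fun c => measurable_pi_apply c)
  let φ : ∀ K : Finset V, (comps K → Bool) → K → Bool := fun K ζ v =>
    if hv : ω v = true then ζ ⟨_, hmem K v hv⟩ else false
  have hφ : ∀ K, Measurable (φ K) := by
    intro K
    refine measurable_pi_lambda _ fun v => ?_
    by_cases hv : ω v = true
    · simpa [φ, hv] using measurable_pi_apply _
    · simp [φ, hv]
  exact hind.comp (hφ K) (hφ L)

end

section Translation

variable {Γ : Type*} [Group Γ] (S : Set Γ)

/-- Translation maps the open subgraph of a configuration to that of its translate. -/
def openGraphSmulIso (g : Γ) (ω : SiteConfig Γ) :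
    openGraph (SimpleGraph.mulCayley S) ω ≃g openGraph (SimpleGraph.mulCayley S) (g • ω) where
  toEquiv := (Equiv.mulLeft g).subtypeEquiv fun v => by
    change ω v = true ↔ ω (g⁻¹ * (g * v)) = true
    rw [inv_mul_cancel_left]
  map_rel_iff' := by
    intro u v
    exact SimpleGraph.mulCayley_adj_mul_iff_right

theorem retain_smul (g : Γ) (ω : SiteConfig Γ)
    (ξ : (openGraph (SimpleGraph.mulCayley S) (g • ω)).ConnectedComponent → Bool) :
    retain (SimpleGraph.mulCayley S) (g • ω) ξ = g • retain (SimpleGraph.mulCayley S) ω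
      (fun c => ξ ((openGraphSmulIso S g ω).connectedComponentEquiv c)) := by
  funext v
  rw [SiteConfig.smul_apply]
  by_cases h : ω (g⁻¹ * v) = true
  · have h' : (g • ω) v = true := h
    simp only [retain, h, h', dif_pos]
    congr 1
    refine congrArg _ (Subtype.ext ?_)
    exact (mul_inv_cancel_left g v).symm
  · have h' : ¬ (g • ω) v = true := h
    simp [retain, h, h']

/-- Translation permutes the clusters, and relabelling i.i.d. coins along a bijection preserves
their law. -/
theorem thinLaw_smul (q : I) (g : Γ) (ω : SiteConfig Γ) :
    thinLaw (SimpleGraph.mulCayley S) q (g • ω) =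
      (thinLaw (SimpleGraph.mulCayley S) q ω).map (g • ·) := by
  let e := (openGraphSmulIso S g ω).connectedComponentEquiv
  have hmap := Measure.map_infinitePi_infinitePi_of_inj
    (P := fun _ => bernoulliMeasure true false q) e.injective
  have hm : Measurable fun (ξ : (openGraph (SimpleGraph.mulCayley S) (g • ω)).ConnectedComponent →
      Bool) c => ξ (e c) := measurable_pi_lambda _ fun c => measurable_pi_apply _
  rw [thinLaw, thinLaw, ← hmap, Measure.map_map (measurable_retain _ _) hm,
    Measure.map_map (measurable_const_smul g) ((measurable_retain _ _).comp hm)]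
  congr 1
  funext ξ
  exact retain_smul S g ω ξ

theorem smulInvariantMeasure_thinned [Countable Γ] (q : I) (μ : Measure (SiteConfig Γ))
    [SMulInvariantMeasure Γ (SiteConfig Γ) μ] :
    SMulInvariantMeasure Γ (SiteConfig Γ) (thinned (SimpleGraph.mulCayley S) q μ) :=
  smulInvariantMeasure_bind (measurable_thinLaw _ q) (thinLaw_smul S q)

end Translation

end SitePercolation

/-! ### Every cluster has a frequency -/

theorem bernoulliMeasure_half_map_not (p : I) (hp : (p : ℝ) = 1 / 2) :
    (bernoulliMeasure true false p).map not = bernoulliMeasure true false p := by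
  have hσ : unitInterval.symm p = p := by
    ext
    rw [unitInterval.coe_symm_eq, hp]
    norm_num
  rw [bernoulliMeasure_def, hσ, Measure.map_add _ _ (by fun_prop), Measure.map_smul,
    Measure.map_smul, Measure.map_dirac' .of_discrete, Measure.map_dirac' .of_discrete, add_comm]
  rfl

open scoped Classical in
/-- Flipping one coordinate of a family of independent fair coins preserves their law. -/
theorem measurePreserving_flip {ι : Type*} (c : ι) (p : I) (hp : (p : ℝ) = 1 / 2) :
    MeasurePreserving (fun (ξ : ι → Bool) i => if i = c then !ξ i else ξ i)
      (Measure.infinitePi fun _ => bernoulliMeasure true false p)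
      (Measure.infinitePi fun _ => bernoulliMeasure true false p) := by
  have hm : ∀ i, Measurable (fun b : Bool => if i = c then !b else b) := fun i => .of_discrete
  refine ⟨measurable_pi_lambda _ fun i => (hm i).comp (measurable_pi_apply i), ?_⟩
  rw [Measure.infinitePi_map_pi (f := fun i b => if i = c then !b else b) _ hm]
  congr 1
  funext i
  by_cases h : i = c
  · simpa [h] using bernoulliMeasure_half_map_not p hp
  · simp [h]

namespace SitePercolation

section

variable {Γ : Type*} {S : Set Γ}

theorem visitAverage_nonneg (C : Set Γ) (X : ℕ → Γ) (N : ℕ) : 0 ≤ visitAverage C X N :=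
  div_nonneg (Finset.sum_nonneg fun n _ => by split_ifs <;> norm_num) (Nat.cast_nonneg N)

open scoped Classical in
theorem visitAverage_eq_mul_sub {A B C : Set Γ} {ε : ℝ}
    (h : ∀ x, (if x ∈ C then (1 : ℝ) else 0) =
      ε * ((if x ∈ A then (1 : ℝ) else 0) - if x ∈ B then (1 : ℝ) else 0))
    (X : ℕ → Γ) (N : ℕ) :
    visitAverage C X N = ε * (visitAverage A X N - visitAverage B X N) := by
  simp only [visitAverage, h]
  rw [← Finset.mul_sum, Finset.sum_sub_distrib]
  ring

variable [Group Γ]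

open scoped Classical in
theorem HasFrequency.mul_sub [MeasurableSpace Γ] {A B C : Set Γ} {a b ε : ℝ}
    (hA : HasFrequency S A a) (hB : HasFrequency S B b)
    (h : ∀ x, (if x ∈ C then (1 : ℝ) else 0) =
      ε * ((if x ∈ A then (1 : ℝ) else 0) - if x ∈ B then (1 : ℝ) else 0)) :
    HasFrequency S C (ε * (a - b)) := by
  intro v
  filter_upwards [hA v, hB v] with z h1 h2
  exact ((h1.sub h2).const_mul ε).congr fun N => (visitAverage_eq_mul_sub h _ N).symm

theorem countable_of_closure_eq_top (hfin : S.Finite) (hgen : Subgroup.closure S = ⊤) :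
    Countable Γ := by
  have := hfin.countable.to_subtype
  have : Countable (FreeGroup S) := Quot.mk_surjective.countable
  have hr := FreeGroup.range_lift_eq_closure (f := ((↑) : S → Γ))
  rw [Subtype.range_coe, hgen, MonoidHom.range_eq_top] at hr
  exact hr.countable

open scoped Pointwise in
theorem finite_neighborSet_one (hfin : S.Finite) :
    ((SimpleGraph.mulCayley S).neighborSet 1).Finite := by
  refine (hfin.union hfin.inv).subset fun u hu => ?_
  obtain ⟨_, g, hg, h | h⟩ := (SimpleGraph.mulCayley_adj' S 1 u).1 hu
  · left; rwa [← h, one_mul]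
  · right; rwa [Set.mem_inv, inv_eq_of_mul_eq_one_right h.symm]

theorem closure_neighborSet_one (hgen : Subgroup.closure S = ⊤) :
    Subgroup.closure ((SimpleGraph.mulCayley S).neighborSet 1) = ⊤ := by
  rw [eq_top_iff, ← hgen, Subgroup.closure_le]
  intro s hs
  by_cases h : s = 1
  · rw [h]; exact Subgroup.one_mem _
  · exact Subgroup.subset_closure ((SimpleGraph.mulCayley_adj' S 1 s).2
      ⟨fun h' => h h'.symm, s, hs, Or.inl (one_mul s)⟩)

theorem neighborSet_one_nonempty [Infinite Γ] (hgen : Subgroup.closure S = ⊤) :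
    ((SimpleGraph.mulCayley S).neighborSet 1).Nonempty := by
  rw [Set.nonempty_iff_ne_empty]
  intro h
  have h1 := closure_neighborSet_one hgen
  rw [h, Subgroup.closure_empty] at h1
  exact not_subsingleton Γ (Subgroup.subsingleton_iff.1 (subsingleton_of_bot_eq_top h1))

variable [MeasurableSpace Γ] [DiscreteMeasurableSpace Γ]

theorem uniformOn_neighborSet_ne_zero (hfin : S.Finite) {s : Γ}
    (hs : s ∈ (SimpleGraph.mulCayley S).neighborSet 1) :
    uniformOn ((SimpleGraph.mulCayley S).neighborSet 1) {s} ≠ 0 := by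
  rw [Ne, uniformOn_eq_zero_iff (finite_neighborSet_one hfin)]
  exact fun h => (h ▸ ⟨hs, rfl⟩ : s ∈ (∅ : Set Γ))

variable [Infinite Γ]

theorem isProbabilityMeasure_uniformOn_neighborSet (hfin : S.Finite)
    (hgen : Subgroup.closure S = ⊤) :
    IsProbabilityMeasure (uniformOn ((SimpleGraph.mulCayley S).neighborSet 1)) :=
  isProbabilityMeasure_uniformOn (finite_neighborSet_one hfin) (neighborSet_one_nonempty hgen)

/-- The set of open vertices of a stationary configuration almost surely has a frequency. -/
theorem ae_exists_hasFrequency (hfin : S.Finite) (hgen : Subgroup.closure S = ⊤)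
    (m : Measure (SiteConfig Γ)) [IsProbabilityMeasure m]
    [SMulInvariantMeasure Γ (SiteConfig Γ) m] :
    ∀ᵐ ω ∂m, ∃ α, HasFrequency S {v | ω v = true} α := by
  have := countable_of_closure_eq_top hfin hgen
  have := isProbabilityMeasure_uniformOn_neighborSet hfin hgen
  have hρ : Subgroup.closure {s : Γ |
      uniformOn ((SimpleGraph.mulCayley S).neighborSet 1) {s} ≠ 0} = ⊤ := by
    rw [eq_top_iff, ← closure_neighborSet_one hgen]
    exact Subgroup.closure_mono fun s hs => uniformOn_neighborSet_ne_zero hfin hs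
  -- The observable is the state of the identity: seen from `Xₙ`, it is the state of `Xₙ` in `ω`.
  have key := ae_exists_tendsto_walk_average _ hρ m
    (f := fun ω : SiteConfig Γ => if ω 1 = true then (1 : ℝ) else 0)
    (Measurable.ite (measurable_pi_apply (X := fun _ : Γ => Bool) 1 (measurableSet_singleton true))
      measurable_const measurable_const)
    (fun ω => by split_ifs <;> norm_num)
    (fun ω => by split_ifs <;> norm_num)
  filter_upwards [key] with ω ⟨α, hα⟩
  refine ⟨α, fun v => ?_⟩
  filter_upwards [hα v] with z hz
  refine hz.congr fun N => ?_
  unfold visitAverage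
  congr 1
  refine Finset.sum_congr rfl fun n _ => ?_
  have : ((walk v z n)⁻¹ • ω) 1 = ω (walk v z n) := by
    rw [SiteConfig.smul_apply, inv_inv, mul_one]
  simp [this]

/-- The clusters of a stationary configuration almost surely all have a frequency. -/
theorem ae_forall_cluster_hasFrequency (hfin : S.Finite) (hgen : Subgroup.closure S = ⊤)
    (μ : Measure (SiteConfig Γ)) [IsProbabilityMeasure μ]
    [SMulInvariantMeasure Γ (SiteConfig Γ) μ] :
    ∀ᵐ ω ∂μ, ∀ C ∈ clusters (SimpleGraph.mulCayley S) ω, ∃ α, HasFrequency S C α := by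
  classical
  have := countable_of_closure_eq_top hfin hgen
  -- Fair coins, so that flipping one of them preserves the law; only stationarity of the thinned
  -- measure is needed here.
  let p : I := ⟨1 / 2, by norm_num, by norm_num⟩
  have := smulInvariantMeasure_thinned S p μ
  have hae := ae_exists_hasFrequency hfin hgen (thinned (SimpleGraph.mulCayley S) p μ)
  filter_upwards [Measure.ae_ae_of_ae_bind (measurable_thinLaw _ p).aemeasurable hae] with ω hω
  rintro C ⟨c, rfl⟩
  have h1 := ae_of_ae_map (measurable_retain _ ω).aemeasurable hω
  -- Some labelling yields a frequency both before and after the label of `c` is flipped. The two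
  -- retained sets differ exactly by the cluster, with a sign given by the original label.
  have h2 := (measurePreserving_flip c p rfl).quasiMeasurePreserving.ae h1
  obtain ⟨ξ, ⟨a, ha⟩, b, hb⟩ := (h1.and h2).exists
  refine ⟨_, ha.mul_sub hb (ε := if ξ c = true then 1 else -1) fun x => ?_⟩
  by_cases hx : ω x = true
  · by_cases hxc : (openGraph (SimpleGraph.mulCayley S) ω).connectedComponentMk ⟨x, hx⟩ = c
    · have hmem : x ∈ (Subtype.val '' c.supp : Set Γ) := ⟨⟨x, hx⟩, hxc, rfl⟩
      rw [if_pos hmem]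
      cases hξ : ξ c <;> simp [retain, hx, hxc, hξ]
    · have hmem : x ∉ (Subtype.val '' c.supp : Set Γ) := by
        rintro ⟨y, hy, rfl⟩
        exact hxc hy
      rw [if_neg hmem]
      simp [retain, hx, hxc]
  · have hmem : x ∉ (Subtype.val '' c.supp : Set Γ) := by
      rintro ⟨y, hy, rfl⟩
      exact hx y.2
    rw [if_neg hmem]
    simp [retain, hx]

/-- A frequency is a limit of nonnegative averages along at least one sample walk, and off the event
`𝓕` it cannot be positive. -/
theorem ae_forall_cluster_hasFrequency_zero (hfin : S.Finite) (hgen : Subgroup.closure S = ⊤)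
    (μ : Measure (SiteConfig Γ)) [IsProbabilityMeasure μ]
    [SMulInvariantMeasure Γ (SiteConfig Γ) μ] (hμ : μ (positiveFrequencyEvent S) = 0) :
    ∀ᵐ ω ∂μ, ∀ C ∈ clusters (SimpleGraph.mulCayley S) ω, HasFrequency S C 0 := by
  have := isProbabilityMeasure_stepLaw hfin hgen
  filter_upwards [ae_forall_cluster_hasFrequency hfin hgen μ, measure_eq_zero_iff_ae_notMem.1 hμ]
    with ω h1 h2 C hC
  obtain ⟨α, hα⟩ := h1 C hC
  obtain ⟨z, hz⟩ := (hα 1).exists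
  have h0 : 0 ≤ α := ge_of_tendsto' hz fun N => visitAverage_nonneg _ _ _
  have h3 : ¬ 0 < α := fun h => h2 ⟨C, hC, α, h, hα⟩
  rwa [le_antisymm (not_lt.1 h3) h0] at hα

end

end SitePercolation

/-! ### Connection probabilities along the walk -/

/-- If the Cesàro means of `b` tend to zero and `c n ≤ C * b (n + 1)`, then those of `c` do. -/
theorem tendsto_cesaro_zero_of_le_succ {b c : ℕ → ℝ} {C : ℝ} (hC : 0 ≤ C) (hb : ∀ n, 0 ≤ b n)
    (hc : ∀ n, 0 ≤ c n) (hcb : ∀ n, c n ≤ C * b (n + 1))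
    (h : Tendsto (fun N : ℕ => (∑ n ∈ Finset.range N, b n) / N) atTop (𝓝 0)) :
    Tendsto (fun N : ℕ => (∑ n ∈ Finset.range N, c n) / N) atTop (𝓝 0) := by
  -- The factor 2 bounds `(N + 1) / N` for `N ≥ 1`.
  have h1 := ((tendsto_add_atTop_iff_nat 1).2 h).const_mul (2 * C)
  rw [mul_zero] at h1
  refine tendsto_of_tendsto_of_tendsto_of_le_of_le' tendsto_const_nhds h1
    (Eventually.of_forall fun N => div_nonneg (Finset.sum_nonneg fun n _ => hc n)
      (Nat.cast_nonneg N)) ?_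
  filter_upwards [eventually_ge_atTop 1] with N hN
  have hN' : (1 : ℝ) ≤ N := by exact_mod_cast hN
  have hs0 : 0 ≤ ∑ n ∈ Finset.range (N + 1), b n := Finset.sum_nonneg fun n _ => hb n
  have hs : ∑ n ∈ Finset.range N, c n ≤ C * ∑ n ∈ Finset.range (N + 1), b n := by
    rw [Finset.sum_range_succ', mul_add, Finset.mul_sum]
    exact (Finset.sum_le_sum fun n _ => hcb n).trans
      (le_add_of_nonneg_right (mul_nonneg hC (hb 0)))
  have hN0 : (0 : ℝ) < N := by linarith
  rw [div_le_iff₀ hN0]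
  refine hs.trans ?_
  push_cast
  rw [mul_assoc, mul_assoc, mul_comm 2, mul_assoc]
  refine mul_le_mul_of_nonneg_left ?_ hC
  rw [div_mul_eq_mul_div, div_mul_eq_mul_div, le_div_iff₀ (by linarith)]
  nlinarith

theorem exists_lt_of_tendsto_cesaro_zero {b : ℕ → ℝ}
    (h : Tendsto (fun N : ℕ => (∑ n ∈ Finset.range N, b n) / N) atTop (𝓝 0)) {ε : ℝ}
    (hε : 0 < ε) : ∃ n, b n < ε := by
  by_contra hcon
  push Not at hcon
  obtain ⟨N, hN, hN1⟩ := ((h.eventually (gt_mem_nhds hε)).and (eventually_ge_atTop 1)).exists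
  have hN0 : (0 : ℝ) < N := by exact_mod_cast hN1
  rw [div_lt_iff₀ hN0] at hN
  have := Finset.card_nsmul_le_sum (Finset.range N) b ε fun n _ => hcon n
  rw [Finset.card_range, nsmul_eq_mul] at this
  linarith

namespace SitePercolation

variable {Γ : Type*} [Group Γ]

theorem walk_congr (v : Γ) {z z' : ℕ → Γ} {n : ℕ} (h : ∀ i < n, z i = z' i) :
    walk v z n = walk v z' n := by
  induction n with
  | zero => rfl
  | succ n ih =>
    simp only [walk]
    rw [ih fun i hi => h i (Nat.lt_succ_of_lt hi), h n (Nat.lt_succ_self n)]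

variable [MeasurableSpace Γ] [DiscreteMeasurableSpace Γ] [Countable Γ]

theorem measurable_walk (v : Γ) (n : ℕ) : Measurable fun z : ℕ → Γ => walk v z n := by
  induction n with
  | zero => exact measurable_const
  | succ n ih =>
    exact (Measurable.of_discrete (f := fun p : Γ × Γ => p.1 * p.2)).comp
      (ih.prodMk (measurable_pi_apply n))

theorem indepFun_walk_eval (ρ : Measure Γ) [IsProbabilityMeasure ρ] (v : Γ) (n : ℕ) :
    IndepFun (fun z : ℕ → Γ => walk v z n) (fun z => z n) (Measure.infinitePi fun _ : ℕ => ρ) := by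
  have hind := (iIndepFun_infinitePi (P := fun _ : ℕ => ρ) (X := fun _ g => g)
    (fun _ => measurable_id)).indepFun_finset (Finset.range n) {n} (by simp)
    (fun i => measurable_pi_apply i)
  -- The default value 1 is never read: the position at time `n` uses only the increments before
  -- `n`.
  let ext : (Finset.range n → Γ) → ℕ → Γ := fun ζ i => if h : i ∈ Finset.range n then ζ ⟨i, h⟩ else 1
  have hext : Measurable ext := by
    refine measurable_pi_lambda _ fun i => ?_
    by_cases h : i ∈ Finset.range n
    · simp only [ext, h, dif_pos]
      exact measurable_pi_apply _
    · simp only [ext, h, dif_neg, not_false_eq_true]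
      exact measurable_const
  have h := hind.comp ((measurable_walk v n).comp hext)
    (measurable_pi_apply (X := fun _ : ({n} : Finset ℕ) => Γ) ⟨n, Finset.mem_singleton_self n⟩)
  have e : (fun z : ℕ → Γ => walk v z n) = ((fun z => walk v z n) ∘ ext) ∘
      fun (z : ℕ → Γ) (i : Finset.range n) => z i := by
    funext z
    refine walk_congr v fun i hi => ?_
    simp [ext, hi]
  rw [e]
  exact h

variable (G : SimpleGraph Γ)

theorem measurableSet_sameCluster_walk (x y : Γ) (n : ℕ) :
    MeasurableSet {p : SiteConfig Γ × (ℕ → Γ) | SameCluster G p.1 x (walk 1 p.2 n * y)} := by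
  have : {p : SiteConfig Γ × (ℕ → Γ) | SameCluster G p.1 x (walk 1 p.2 n * y)} =
      ⋃ g : Γ, (Prod.fst ⁻¹' {ω | SameCluster G ω x (g * y)}) ∩
        (Prod.snd ⁻¹' ((fun z => walk 1 z n) ⁻¹' {g})) := by
    ext p
    simp
  rw [this]
  exact .iUnion fun g => (measurable_fst (measurableSet_sameCluster G x (g * y))).inter
    (measurable_snd (measurable_walk 1 n (.of_discrete)))

/-- The probability that `x` is connected to the image of `y` under the walk at time `n`. -/
noncomputable def connProb (ρ : Measure Γ) (μ : Measure (SiteConfig Γ)) (x y : Γ) (n : ℕ) : ℝ :=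
  (μ.prod (Measure.infinitePi fun _ : ℕ => ρ)).real
    {p | SameCluster G p.1 x (walk 1 p.2 n * y)}

variable (ρ : Measure Γ) [IsProbabilityMeasure ρ] (μ : Measure (SiteConfig Γ))
  [IsProbabilityMeasure μ]

/-- If the increment at time `n` is `s`, then `Xₙ₊₁ y = Xₙ (s y)`; this increment is independent of
`Xₙ` and of `ω`. It lets the decay of Cesàro means pass from `y` to `s y`. -/
theorem connProb_mul_le (x y s : Γ) (n : ℕ) :
    connProb G ρ μ x (s * y) n * ρ.real {s} ≤ connProb G ρ μ x y (n + 1) := by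
  set P : Measure (ℕ → Γ) := Measure.infinitePi fun _ : ℕ => ρ with hP
  let A : Set (SiteConfig Γ × (ℕ → Γ)) := {p | SameCluster G p.1 x (walk 1 p.2 n * (s * y))}
  let B : Set (SiteConfig Γ × (ℕ → Γ)) := {p | p.2 n = s}
  have hA : MeasurableSet A := measurableSet_sameCluster_walk G x (s * y) n
  have hB : MeasurableSet B :=
    measurableSet_eq_fun ((measurable_pi_apply n).comp measurable_snd) measurable_const
  have hAB : (μ.prod P) (A ∩ B) = (μ.prod P) A * ρ {s} := by
    rw [Measure.prod_apply (hA.inter hB), Measure.prod_apply hA,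
      ← lintegral_mul_const _ (measurable_measure_prodMk_left hA)]
    refine lintegral_congr fun ω => ?_
    have h := (indepFun_iff_measure_inter_preimage_eq_mul.1 (indepFun_walk_eval ρ 1 n))
      {g | SameCluster G ω x (g * (s * y))} {s} .of_discrete .of_discrete
    have h2 : P ((fun z => z n) ⁻¹' {s}) = ρ {s} :=
      (measurePreserving_eval_infinitePi (fun _ : ℕ => ρ) n).measure_preimage
        (MeasurableSet.of_discrete (s := {s})).nullMeasurableSet
    rw [← hP, h2] at h
    exact h
  have hle : (μ.prod P).real (A ∩ B) ≤ connProb G ρ μ x y (n + 1) := by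
    refine measureReal_mono ?_
    rintro p ⟨hpA, hpB⟩
    change SameCluster G p.1 x (walk 1 p.2 n * p.2 n * y)
    rw [show p.2 n = s from hpB, mul_assoc]
    exact hpA
  refine le_trans (le_of_eq ?_) hle
  simp only [measureReal_def, hAB, ENNReal.toReal_mul]
  rfl

/-- The Cesàro mean is the expected visit average of the cluster of `x`, so dominated convergence
applies. -/
theorem tendsto_cesaro_connProb_one {x : Γ}
    (h : ∀ᵐ ω ∂μ, ∀ᵐ z ∂(Measure.infinitePi fun _ : ℕ => ρ),
      Tendsto (visitAverage {u | SameCluster G ω x u} (walk 1 z)) atTop (𝓝 0)) :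
    Tendsto (fun N : ℕ => (∑ n ∈ Finset.range N, connProb G ρ μ x 1 n) / N) atTop (𝓝 0) := by
  classical
  set P : Measure (ℕ → Γ) := Measure.infinitePi fun _ : ℕ => ρ with hP
  let A : ℕ → Set (SiteConfig Γ × (ℕ → Γ)) := fun n => {p | SameCluster G p.1 x (walk 1 p.2 n * 1)}
  have hA : ∀ n, MeasurableSet (A n) := fun n => measurableSet_sameCluster_walk G x 1 n
  let W : ℕ → SiteConfig Γ × (ℕ → Γ) → ℝ := fun N p =>
    (∑ n ∈ Finset.range N, (A n).indicator 1 p) / N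
  have hWm : ∀ N, Measurable (W N) := fun N =>
    (Finset.measurable_fun_sum _ fun n _ => measurable_one.indicator (hA n)).div_const _
  have hW : ∀ N p, W N p = visitAverage {u | SameCluster G p.1 x u} (walk 1 p.2) N := by
    intro N p
    simp only [W, visitAverage, A, mul_one, Set.indicator_apply, Set.mem_ofPred_eq, Pi.one_apply]
  have hWae : ∀ᵐ p ∂(μ.prod P), Tendsto (fun N => W N p) atTop (𝓝 0) := by
    rw [Measure.ae_prod_iff_ae_ae (measurableSet_tendsto (𝓝 0) hWm)]
    filter_upwards [h] with ω hω
    filter_upwards [hω] with z hz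
    exact hz.congr fun N => (hW N (ω, z)).symm
  have hint : ∀ N, ∫ p, W N p ∂(μ.prod P) = (∑ n ∈ Finset.range N, connProb G ρ μ x 1 n) / N := by
    intro N
    simp only [W]
    rw [integral_div, integral_finsetSum]
    · congr 1
      exact Finset.sum_congr rfl fun n _ => integral_indicator_one (hA n)
    · exact fun n _ => (integrable_const (1 : ℝ)).indicator (hA n)
  have hlim := tendsto_integral_of_dominated_convergence (μ := μ.prod P) (F := W) (f := fun _ => 0)
    (fun _ => 1) (fun N => (hWm N).aestronglyMeasurable) (integrable_const 1)
    (fun N => Eventually.of_forall fun p => ?_) hWae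
  · simp only [hint, integral_zero] at hlim
    exact hlim
  · have h0 : ∀ n, 0 ≤ (A n).indicator (1 : SiteConfig Γ × (ℕ → Γ) → ℝ) p := fun n =>
      Set.indicator_nonneg (fun _ _ => zero_le_one) p
    have h1 : ∀ n, (A n).indicator (1 : SiteConfig Γ × (ℕ → Γ) → ℝ) p ≤ 1 := fun n =>
      Set.indicator_le_self' (fun _ _ => zero_le_one) p
    rw [Real.norm_eq_abs, abs_of_nonneg (div_nonneg (Finset.sum_nonneg fun n _ => h0 n)
      (Nat.cast_nonneg N))]
    refine div_le_one_of_le₀ ?_ (Nat.cast_nonneg N)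
    refine (Finset.sum_le_sum fun n _ => h1 n).trans ?_
    simp

theorem tendsto_cesaro_connProb_mul {x y s : Γ} (hs : ρ {s} ≠ 0)
    (h : Tendsto (fun N : ℕ => (∑ n ∈ Finset.range N, connProb G ρ μ x y n) / N) atTop (𝓝 0)) :
    Tendsto (fun N : ℕ => (∑ n ∈ Finset.range N, connProb G ρ μ x (s * y) n) / N)
      atTop (𝓝 0) := by
  have hpos : 0 < ρ.real {s} := ENNReal.toReal_pos hs (measure_ne_top _ _)
  refine tendsto_cesaro_zero_of_le_succ (C := (ρ.real {s})⁻¹) (inv_nonneg.2 hpos.le)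
    (fun n => measureReal_nonneg) (fun n => measureReal_nonneg) (fun n => ?_) h
  rw [inv_mul_eq_div, le_div_iff₀ hpos]
  exact connProb_mul_le G ρ μ x y s n

end SitePercolation

namespace SitePercolation

variable {Γ : Type*} [Group Γ] [MeasurableSpace Γ] [DiscreteMeasurableSpace Γ] {S : Set Γ}

theorem setOf_sameCluster_mem_clusters {V : Type*} (G : SimpleGraph V) {ω : SiteConfig V} {x : V}
    (hx : ω x = true) : {u | SameCluster G ω x u} ∈ clusters G ω := by
  refine ⟨(openGraph G ω).connectedComponentMk ⟨x, hx⟩, ?_⟩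
  ext u
  constructor
  · rintro ⟨_, hu, h⟩
    exact ⟨⟨u, hu⟩, SimpleGraph.ConnectedComponent.sound h.symm, rfl⟩
  · rintro ⟨u, hu, rfl⟩
    exact ⟨hx, u.2, (SimpleGraph.ConnectedComponent.exact hu).symm⟩

/-- Induction on a word for `y`: frequency zero settles `y = 1`, and each letter is a step of
positive probability. -/
theorem tendsto_cesaro_connProb [Infinite Γ] (hfin : S.Finite) (hgen : Subgroup.closure S = ⊤)
    (μ : Measure (SiteConfig Γ)) [IsProbabilityMeasure μ]
    [SMulInvariantMeasure Γ (SiteConfig Γ) μ] (hμ : μ (positiveFrequencyEvent S) = 0) (x y : Γ) :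
    Tendsto (fun N : ℕ => (∑ n ∈ Finset.range N, connProb (SimpleGraph.mulCayley S)
      (uniformOn ((SimpleGraph.mulCayley S).neighborSet 1)) μ x y n) / N) atTop (𝓝 0) := by
  have := countable_of_closure_eq_top hfin hgen
  have := isProbabilityMeasure_uniformOn_neighborSet hfin hgen
  have hy : y ∈ Subgroup.closure ((SimpleGraph.mulCayley S).neighborSet 1) :=
    closure_neighborSet_one hgen ▸ Subgroup.mem_top y
  have hstep : ∀ s ∈ (SimpleGraph.mulCayley S).neighborSet 1,
      s⁻¹ ∈ (SimpleGraph.mulCayley S).neighborSet 1 := by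
    intro s hs
    have h : (SimpleGraph.mulCayley S).Adj (s⁻¹ * 1) (s⁻¹ * s) :=
      SimpleGraph.mulCayley_adj_mul_iff_right.2 hs
    rw [mul_one, inv_mul_cancel] at h
    exact h.symm
  induction hy using Subgroup.closure_induction_left with
  | one =>
    refine tendsto_cesaro_connProb_one _ _ μ ?_
    filter_upwards [ae_forall_cluster_hasFrequency_zero hfin hgen μ hμ] with ω hω
    by_cases hx : ω x = true
    · exact hω _ (setOf_sameCluster_mem_clusters _ hx) 1
    · have h0 : ∀ u, ¬ SameCluster (SimpleGraph.mulCayley S) ω x u := fun u h => hx h.1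
      refine Eventually.of_forall fun z => ?_
      refine tendsto_const_nhds.congr fun N => ?_
      simp [visitAverage, h0]
  | mul_left s hs y _ ih =>
    exact tendsto_cesaro_connProb_mul _ _ μ (uniformOn_neighborSet_ne_zero hfin hs) ih
  | inv_mul_cancel s hs y _ ih =>
    exact tendsto_cesaro_connProb_mul _ _ μ (uniformOn_neighborSet_ne_zero hfin (hstep s hs)) ih

/-- If all clusters have frequency zero, every finite set has a translate to which it is connected
with small probability, simultaneously for finitely many laws. -/
theorem exists_translate_connection_le [Infinite Γ] (hfin : S.Finite)
    (hgen : Subgroup.closure S = ⊤) {ι : Type*} [Fintype ι] (ν : ι → Measure (SiteConfig Γ))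
    [∀ i, IsProbabilityMeasure (ν i)] [∀ i, SMulInvariantMeasure Γ (SiteConfig Γ) (ν i)]
    (hν : ∀ i, ν i (positiveFrequencyEvent S) = 0) (K : Finset Γ) {ε : ENNReal} (hε : 0 < ε) :
    ∃ g : Γ, ∑ i, ∑ x ∈ K, ∑ y ∈ K,
      ν i {ω | SameCluster (SimpleGraph.mulCayley S) ω x (g * y)} ≤ ε := by
  have := countable_of_closure_eq_top hfin hgen
  have := isProbabilityMeasure_uniformOn_neighborSet hfin hgen
  set G := SimpleGraph.mulCayley S
  set ρ := uniformOn (G.neighborSet 1)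
  set P : Measure (ℕ → Γ) := Measure.infinitePi fun _ : ℕ => ρ with hP
  obtain ⟨δ, hδ, hδε⟩ : ∃ δ : ℝ, 0 < δ ∧ ENNReal.ofReal δ ≤ ε := by
    obtain ⟨δ, hδ, hδε⟩ := ENNReal.lt_iff_exists_nnreal_btwn.1 hε
    exact ⟨δ, by exact_mod_cast hδ, by simpa using hδε.le⟩
  -- Cesàro means add up, so one time `n` serves all pairs and all laws at once.
  have hces : Tendsto (fun N : ℕ => (∑ n ∈ Finset.range N, ∑ i, ∑ x ∈ K, ∑ y ∈ K,
      connProb G ρ (ν i) x y n) / N) atTop (𝓝 0) := by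
    have h : Tendsto (fun N : ℕ => ∑ i, ∑ x ∈ K, ∑ y ∈ K,
        (∑ n ∈ Finset.range N, connProb G ρ (ν i) x y n) / N) atTop
        (𝓝 (∑ _i : ι, ∑ _x ∈ K, ∑ _y ∈ K, (0 : ℝ))) := by
      refine tendsto_finsetSum _ fun i _ => ?_
      refine tendsto_finsetSum _ fun x _ => ?_
      refine tendsto_finsetSum _ fun y _ => ?_
      exact tendsto_cesaro_connProb hfin hgen (ν i) (hν i) x y
    simp only [Finset.sum_const_zero] at h
    refine h.congr fun N => ?_
    simp only [← Finset.sum_div]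
    congr 1
    simp only [Finset.sum_comm (s := Finset.range N)]
  obtain ⟨n, hn⟩ := exists_lt_of_tendsto_cesaro_zero hces hδ
  have hm : ∀ i x y, Measurable fun z : ℕ → Γ => ν i {ω | SameCluster G ω x (walk 1 z n * y)} :=
    fun i x y => measurable_measure_prodMk_right (measurableSet_sameCluster_walk G x y n)
  have hb : ∀ i x y, ENNReal.ofReal (connProb G ρ (ν i) x y n) =
      ∫⁻ z, ν i {ω | SameCluster G ω x (walk 1 z n * y)} ∂P := by
    intro i x y
    rw [connProb, ofReal_measureReal,
      Measure.prod_apply_symm (measurableSet_sameCluster_walk G x y n)]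
    rfl
  have hsum : ∫⁻ z, ∑ i, ∑ x ∈ K, ∑ y ∈ K,
      ν i {ω | SameCluster G ω x (walk 1 z n * y)} ∂P ≤ ε := by
    refine le_trans (le_of_eq ?_) ((ENNReal.ofReal_le_ofReal hn.le).trans hδε)
    have h0 : ∀ i x y, 0 ≤ connProb G ρ (ν i) x y n := fun i x y => measureReal_nonneg
    rw [lintegral_finsetSum _ fun i _ => Finset.measurable_fun_sum _ fun x _ =>
      Finset.measurable_fun_sum _ fun y _ => hm i x y,
      ENNReal.ofReal_sum_of_nonneg fun i _ => Finset.sum_nonneg fun x _ =>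
        Finset.sum_nonneg fun y _ => h0 i x y]
    refine Finset.sum_congr rfl fun i _ => ?_
    rw [lintegral_finsetSum _ fun x _ => Finset.measurable_fun_sum _ fun y _ => hm i x y,
      ENNReal.ofReal_sum_of_nonneg fun x _ => Finset.sum_nonneg fun y _ => h0 i x y]
    refine Finset.sum_congr rfl fun x _ => ?_
    rw [lintegral_finsetSum _ fun y _ => hm i x y,
      ENNReal.ofReal_sum_of_nonneg fun y _ => h0 i x y]
    exact Finset.sum_congr rfl fun y _ => (hb i x y).symm
  -- Some walk does no worse than the average; its position at time `n` is the required translate.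
  obtain ⟨z, hz⟩ := exists_le_lintegral (μ := P) (Finset.measurable_fun_sum Finset.univ fun i _ =>
    Finset.measurable_fun_sum K fun x _ =>
      Finset.measurable_fun_sum K fun y _ => hm i x y).aemeasurable
  exact ⟨walk 1 z n, hz.trans hsum⟩

end SitePercolation

/-! ### Factors, products and local events -/

/-- An invariant event of the factor pulls back to one of the original system. This moves ergodicity
between a law and its one-factor product. -/
theorem IsErgodicLaw.map {Γ X Y : Type*} [Group Γ] [MulAction Γ X] [MulAction Γ Y]
    [MeasurableSpace X] [MeasurableSpace Y] [MeasurableConstSMul Γ X] [MeasurableConstSMul Γ Y]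
    {μ : Measure X} (hμ : IsErgodicLaw Γ μ) {f : X → Y} (hf : Measurable f)
    (hfe : ∀ (g : Γ) x, f (g • x) = g • f x) : IsErgodicLaw Γ (μ.map f) := by
  have := hμ.isProbabilityMeasure
  have := hμ.ergodicSMul
  have hfe' : ∀ (g : Γ) (s : Set Y), f ⁻¹' ((g • ·) ⁻¹' s) = (g • ·) ⁻¹' (f ⁻¹' s) := fun g s => by
    ext x
    simp [hfe]
  refine ⟨Measure.isProbabilityMeasure_map hf.aemeasurable,
    { measure_preimage_smul := fun g s hs => ?_
      aeconst_of_forall_preimage_smul_ae_eq := fun {s} hs h => ?_ }⟩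
  · rw [Measure.map_apply hf (measurable_const_smul g hs), Measure.map_apply hf hs, hfe']
    exact measure_preimage_smul_of_nullMeasurableSet (hf hs).nullMeasurableSet g
  · have hc := aeconst_of_forall_preimage_smul_ae_eq Γ (μ := μ) (hf hs).nullMeasurableSet
      fun g => by
        rw [← hfe']
        exact (hf.measurePreserving μ).quasiMeasurePreserving.preimage_ae_eq (h g)
    rw [eventuallyConst_set] at hc ⊢
    exact hc.imp (fun h => (ae_map_iff hf.aemeasurable hs).2 h)
      (fun h => (ae_map_iff hf.aemeasurable hs.compl).2 h)

namespace SitePercolation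

section Product

variable {V ι : Type*} [Countable V] [Fintype ι] (G : SimpleGraph V) (q : I)

theorem measurable_pi_thinLaw :
    Measurable fun ω : ι → SiteConfig V => Measure.pi fun i => thinLaw G q (ω i) := by
  refine Measurable.measure_of_isPiSystem_of_isProbabilityMeasure generateFrom_pi.symm
    isPiSystem_pi ?_
  rintro _ ⟨s, hs, rfl⟩
  have hs' : ∀ i, MeasurableSet (s i) := fun i => hs i (Set.mem_univ i)
  simp_rw [Measure.pi_pi]
  exact Finset.measurable_fun_prod _ fun i _ =>
    (Measure.measurable_coe (hs' i)).comp
      ((measurable_thinLaw G q).comp (measurable_pi_apply i))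

/-- Thinning the factors of a product law amounts to thinning all the coordinates
independently. -/
theorem pi_thinned (ν : ι → Measure (SiteConfig V)) [∀ i, IsProbabilityMeasure (ν i)] :
    (Measure.pi fun i => thinned G q (ν i)) =
      (Measure.pi ν).bind fun ω => Measure.pi fun i => thinLaw G q (ω i) := by
  refine Measure.pi_eq fun s hs => ?_
  rw [Measure.bind_apply (MeasurableSet.univ_pi hs) (measurable_pi_thinLaw G q).aemeasurable]
  simp_rw [Measure.pi_pi]
  have hm : ∀ i, Measurable fun ω : SiteConfig V => thinLaw G q ω (s i) := fun i =>
    (Measure.measurable_coe (hs i)).comp (measurable_thinLaw G q)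
  rw [lintegral_prod_eq_prod_lintegral_of_indepFun Finset.univ
    (fun i (ω : ι → SiteConfig V) => thinLaw G q (ω i) (s i))
    (iIndepFun_pi fun i => (hm i).aemeasurable) (fun i => (hm i).comp (measurable_pi_apply i))]
  refine Finset.prod_congr rfl fun i _ => ?_
  rw [thinned, Measure.bind_apply (hs i) (measurable_thinLaw G q).aemeasurable]
  exact (measurePreserving_eval ν i).lintegral_comp (hm i)

end Product

/-- The events that depend on the restrictions of finitely many configurations to a finite set. -/
def localEvents (ι V : Type*) : Set (Set (ι → SiteConfig V)) :=
  {B | ∃ (K : Finset V) (D : Set (ι → K → Bool)), MeasurableSet D ∧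
    B = (fun y i (v : K) => y i v) ⁻¹' D}

theorem isSetAlgebra_localEvents (ι V : Type*) : IsSetAlgebra (localEvents ι V) := by
  classical
  refine ⟨⟨∅, ∅, .empty, rfl⟩, ?_, ?_⟩
  · rintro _ ⟨K, D, hD, rfl⟩
    exact ⟨K, Dᶜ, hD.compl, rfl⟩
  · rintro _ _ ⟨K, D, hD, rfl⟩ ⟨L, E, hE, rfl⟩
    refine ⟨K ∪ L, (fun y i (v : K) => y i ⟨v, Finset.mem_union_left _ v.2⟩) ⁻¹' D ∪
      (fun y i (v : L) => y i ⟨v, Finset.mem_union_right _ v.2⟩) ⁻¹' E, ?_, rfl⟩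
    exact (measurable_pi_lambda _ (fun i => measurable_pi_lambda _ fun v =>
      (measurable_pi_apply _).comp (measurable_pi_apply i)) hD).union
      (measurable_pi_lambda _ (fun i => measurable_pi_lambda _ fun v =>
      (measurable_pi_apply _).comp (measurable_pi_apply i)) hE)

theorem measurable_restrict_family {ι V : Type*} (K : Finset V) :
    Measurable fun (y : ι → SiteConfig V) i (v : K) => y i v :=
  measurable_pi_lambda _ fun i => measurable_pi_lambda _ fun v =>
    (measurable_pi_apply (v : V)).comp (measurable_pi_apply i)

theorem generateFrom_localEvents (ι V : Type*) :
    (MeasurableSpace.pi : MeasurableSpace (ι → SiteConfig V)) =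
      MeasurableSpace.generateFrom (localEvents ι V) := by
  refine le_antisymm ?_ (MeasurableSpace.generateFrom_le ?_)
  · have h : @Measurable _ _ (MeasurableSpace.generateFrom (localEvents ι V)) MeasurableSpace.pi
        (id : (ι → SiteConfig V) → ι → SiteConfig V) := by
      let _ := MeasurableSpace.generateFrom (localEvents ι V)
      refine measurable_pi_lambda _ fun i => measurable_pi_lambda _ fun v => ?_
      intro T hT
      refine MeasurableSpace.measurableSet_generateFrom
        ⟨{v}, {d | d i ⟨v, Finset.mem_singleton_self v⟩ ∈ T}, ?_, rfl⟩
      exact ((measurable_pi_apply _).comp (measurable_pi_apply i)) hT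
    exact fun s hs => h hs
  · rintro _ ⟨K, D, hD, rfl⟩
    exact measurable_restrict_family K hD

/-! ### Ergodicity of the thinned measures -/

section Main

variable {Γ ι : Type*} [Group Γ] [Infinite Γ] [MeasurableSpace Γ] [DiscreteMeasurableSpace Γ]
  [Fintype ι] {S : Set Γ}

/-- The mixture criterion is applied over the product law with the local events. Conditional
independence can fail only if, in some coordinate, a vertex of `K` is connected to one of `gK`, and
a union bound controls this. -/
theorem isErgodicLaw_pi_thinned (hfin : S.Finite) (hgen : Subgroup.closure S = ⊤)
    (ν : ι → Measure (SiteConfig Γ)) (hν : ∀ i, IsErgodicLaw Γ (ν i))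
    (hF : ∀ i, ν i (positiveFrequencyEvent S) = 0) (hpi : IsErgodicLaw Γ (Measure.pi ν)) (q : I) :
    IsErgodicLaw Γ (Measure.pi fun i => thinned (SimpleGraph.mulCayley S) q (ν i)) := by
  classical
  have := countable_of_closure_eq_top hfin hgen
  have := fun i => (hν i).isProbabilityMeasure
  have := fun i => (hν i).ergodicSMul
  set G := SimpleGraph.mulCayley S
  rw [pi_thinned]
  refine hpi.bind (measurable_pi_thinLaw G q) (fun ω => inferInstance) (fun g ω => ?_)
    (isSetAlgebra_localEvents ι Γ) (generateFrom_localEvents ι Γ) ?_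
  · have h := Measure.pi_map_pi (μ := fun i => thinLaw G q (ω i))
      (f := fun _ η => g • η) fun i => (measurable_const_smul g).aemeasurable
    have e : (fun i => (thinLaw G q (ω i)).map (g • ·)) = fun i => thinLaw G q ((g • ω) i) :=
      funext fun i => (thinLaw_smul S q g (ω i)).symm
    rw [e] at h
    exact h.symm
  · rintro _ ⟨K, D, hD, rfl⟩ ε hε
    obtain ⟨g, hg⟩ := exists_translate_connection_le hfin hgen ν hF K hε
    -- The inverse appears because `g⁻¹ • y` at `v` is `y` at `g * v`, so the translated event reads
    -- the vertices of `gK`.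
    refine ⟨g⁻¹, le_trans ?_ hg⟩
    let L : Finset Γ := K.image (g * ·)
    have hL : ∀ v : K, g * v ∈ L := fun v => Finset.mem_image_of_mem _ v.2
    let D' : Set (ι → L → Bool) := {d | (fun i (v : K) => d i ⟨g * v, hL v⟩) ∈ D}
    have hD' : MeasurableSet D' := by
      have : Measurable fun (d : ι → L → Bool) i (v : K) => d i ⟨g * v, hL v⟩ :=
        measurable_pi_lambda _ fun i => measurable_pi_lambda _ fun v =>
          (measurable_pi_apply _).comp (measurable_pi_apply i)
      exact this hD
    have hpre : (g⁻¹ • ·) ⁻¹' ((fun (y : ι → SiteConfig Γ) i (v : K) => y i v) ⁻¹' D) =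
        (fun (y : ι → SiteConfig Γ) i (v : L) => y i v) ⁻¹' D' := by
      ext y
      have : (fun i (v : K) => (g⁻¹ • y) i v) = fun i (v : K) => y i (g * v) := by
        funext i v
        rw [Pi.smul_apply, SiteConfig.smul_apply, inv_inv]
      change (fun i (v : K) => (g⁻¹ • y) i v) ∈ D ↔ (fun i (v : K) => y i (g * v)) ∈ D
      rw [this]
    rw [hpre]
    have hsub : {ω : ι → SiteConfig Γ | ¬ (Measure.pi fun i => thinLaw G q (ω i))
        ((fun (y : ι → SiteConfig Γ) i (v : K) => y i v) ⁻¹' D ∩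
          (fun (y : ι → SiteConfig Γ) i (v : L) => y i v) ⁻¹' D') =
        (Measure.pi fun i => thinLaw G q (ω i))
          ((fun (y : ι → SiteConfig Γ) i (v : K) => y i v) ⁻¹' D) *
        (Measure.pi fun i => thinLaw G q (ω i))
          ((fun (y : ι → SiteConfig Γ) i (v : L) => y i v) ⁻¹' D')} ⊆
        ⋃ i ∈ (Finset.univ : Finset ι), ⋃ x ∈ K, ⋃ y ∈ K,
          Function.eval i ⁻¹' {ω | SameCluster G ω x (g * y)} := by
      intro ω hω
      by_contra hcon
      simp only [Set.mem_iUnion, not_exists, Finset.mem_univ, forall_const] at hcon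
      refine hω (indepFun_iff_measure_inter_preimage_eq_mul.1 (IndepFun.pi
        (f := fun (η : SiteConfig Γ) (v : K) => η v) (g := fun (η : SiteConfig Γ) (v : L) => η v)
        (measurable_pi_lambda _ fun v => measurable_pi_apply _)
        (measurable_pi_lambda _ fun v => measurable_pi_apply _) fun i => ?_) D D' hD hD')
      refine indepFun_restrict_thinLaw G q (ω i) K L fun x hx y hy => ?_
      obtain ⟨y, hyK, rfl⟩ := Finset.mem_image.1 hy
      exact hcon i x hx y hyK
    refine (measure_mono hsub).trans ((measure_biUnion_finset_le _ _).trans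
      (Finset.sum_le_sum fun i _ => (measure_biUnion_finset_le _ _).trans
      (Finset.sum_le_sum fun x _ => (measure_biUnion_finset_le _ _).trans
      (Finset.sum_le_sum fun y _ => le_of_eq ?_))))
    exact (measurePreserving_eval ν i).measure_preimage
      (measurableSet_sameCluster G x (g * y)).nullMeasurableSet

/-- This is the product statement with one factor, indexed by `Unit`, pulled back through
evaluation. -/
theorem isErgodicLaw_thinned (hfin : S.Finite) (hgen : Subgroup.closure S = ⊤)
    (μ : Measure (SiteConfig Γ)) (hμ : IsErgodicLaw Γ μ) (hF : μ (positiveFrequencyEvent S) = 0)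
    (q : I) : IsErgodicLaw Γ (thinned (SimpleGraph.mulCayley S) q μ) := by
  have := countable_of_closure_eq_top hfin hgen
  have := hμ.isProbabilityMeasure
  have hpi : IsErgodicLaw Γ (Measure.pi fun _ : Unit => μ) := by
    have hm : Measurable fun (ω : SiteConfig Γ) (_ : Unit) => ω :=
      measurable_pi_lambda _ fun _ => measurable_id
    have h := hμ.map hm fun g x => rfl
    convert h using 1
    refine Measure.pi_eq fun s hs => ?_
    rw [Measure.map_apply hm (MeasurableSet.univ_pi hs)]
    rw [Fintype.prod_unique]
    exact congrArg μ (Set.ext fun ω => ⟨fun h => h () trivial, fun h _ _ => h⟩)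
  have h := (isErgodicLaw_pi_thinned hfin hgen (fun _ : Unit => μ) (fun _ => hμ) (fun _ => hF)
    hpi q).map (f := fun y => y ()) (measurable_pi_apply ()) fun g x => rfl
  rwa [(measurePreserving_eval (fun _ : Unit => thinned (SimpleGraph.mulCayley S) q μ) ()).map_eq]
    at h

end Main

end SitePercolation

theorem mainTheorem6 (Γ : Type*) [Group Γ] [Infinite Γ]
    [MeasurableSpace Γ] [DiscreteMeasurableSpace Γ]
    (S : Finset Γ) (hS : Subgroup.closure (S : Set Γ) = ⊤) :
    (∀ μ : Measure (SiteConfig Γ), IsErgodicLaw Γ μ →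
      μ (SitePercolation.positiveFrequencyEvent (S : Set Γ)) = 0 →
      ∀ q : I, IsErgodicLaw Γ
        (SitePercolation.thinned (SimpleGraph.mulCayley (S : Set Γ)) q μ)) ∧
    (∀ (k : ℕ) (ν : Fin k → Measure (SiteConfig Γ)),
      (∀ i, IsErgodicLaw Γ (ν i)) →
      (∀ i, ν i (SitePercolation.positiveFrequencyEvent (S : Set Γ)) = 0) →
      IsErgodicLaw Γ (Measure.pi ν) →
      ∀ q : I, IsErgodicLaw Γ (Measure.pi fun i =>
        SitePercolation.thinned (SimpleGraph.mulCayley (S : Set Γ)) q (ν i))) :=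
  ⟨fun μ hμ hF q => SitePercolation.isErgodicLaw_thinned S.finite_toSet hS μ hμ hF q,
    fun _ ν hν hF hpi q =>
      SitePercolation.isErgodicLaw_pi_thinned S.finite_toSet hS ν hν hF hpi q⟩
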